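/- Let $n\ge 3$, and let $k$ be a field of characteristic $0$ (for instance $\mathbb{Q}$). Consider the $(n-1)$-rowed table, infinite in both directions, whose entries are indexed by the pairs of integers $(i,j)$ with $1\le j-i\le n-1$; the entry $(i,j)$ stands in row $j-i$ (rows are numbered $1,\dots,n-1$ from top to bottom) at horizontal coordinate $(i+j)/2$. Thus the entries $(i-1,j)$ and $(i,j+1)$ stand just below $(i,j)$, half a step to the left and to the right. Assign the indeterminates $x_1,\dots,x_{n-3}$ (the formal weights), from top to bottom, to a zig-zag joining the top row to the bottom row: one entry in each of the rows $2,\dots,n-2$, the entry $(i,j)$ in one row being followed by $(i-1,j)$ or by $(i,j+1)$ in the next row, arbitrarily. (a) There is a unique assignment of rational functions $f_{i,j}\in k(x_1,\dots,x_{n-3})$ to all entries of the table such that the top and bottom rows consist of $1$'s, the entries of the zig-zag have the assigned values, and the frieze relation $f_{i,j}\,f_{i-1,j+1}=f_{i-1,j}\,f_{i,j+1}-1$ holds whenever all four entries are in the table. (b) The $f_{i,j}$ have the glide-reflection symmetry $f_{i,j}=f_{j,i+n}$ (row $n-m$ is row $m$ shifted by $n/2$ positions), and each row has period $n$: $f_{i+n,j+n}=f_{i,j}$.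 (c) Each $f_{i,j}$ is a nonzero Laurent polynomial in $x_1,\dots,x_{n-3}$ all of whose nonzero coefficients are positive integers. (d) Label the vertices of a convex $n$-gon cyclically by $\mathbb{Z}/n$. The diagonals joining $i$ to $j$ modulo $n$, for the $n-3$ entries $(i,j)$ of the zig-zag, are distinct and pairwise non-crossing, so they form a triangulation $T$ of the $n$-gon. Give each of these diagonals the weight $x_m$ of its entry, and give each side of the $n$-gon the weight $1$. For distinct vertices $i,j$ let $G_{i,j}$ be the bipartite graph whose black vertices are the vertices of the $n$-gon other than $i$ and $j$, whose white vertices are the $n-2$ triangles of $T$, and in which a black vertex $v$ is joined to each triangle $w$ having $v$ as a vertex, by an edge whose weight is that of the side of $w$ opposite to $v$. Let $W_{i,j}$ be the sum over all perfect matchings of $G_{i,j}$ of the product of the weights of their edges. Then for every entry $(i,j)$ of the table $$f_{i,j}=\frac{W_{i,j}}{x_1x_2\cdots x_{n-3}},$$ where the subscripts of $W$ are read modulo $n$. -/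

import Mathlib

open Finset

noncomputable section

namespace FriezeTable

/-- The entries of the `(n - 1)`-rowed table of an `n`-gon. The entry `(i, j)` stands in row `j - i`
(rows are numbered `1, …, n - 1` from top to bottom) at the horizontal coordinate `(i + j) / 2`,
so that consecutive rows are offset by one half and every row is infinite in both directions. -/
@[ext]
structure Entry (n : ℕ) where
  left : ℤ
  right : ℤ
  one_le_row : 1 ≤ right - left
  row_le : right - left ≤ (n : ℤ) - 1

/-- The row of an entry. -/
def Entry.row {n : ℕ} (p : Entry n) : ℤ := p.right - p.left

/-- `q` stands in the row below `p`, half a step to the left. -/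
def LowerLeft {n : ℕ} (p q : Entry n) : Prop := q.left = p.left - 1 ∧ q.right = p.right

/-- `q` stands in the row below `p`, half a step to the right. -/
def LowerRight {n : ℕ} (p q : Entry n) : Prop := q.left = p.left ∧ q.right = p.right + 1

/-- The entries `A` (top), `B` (left), `C` (right), `D` (bottom) form a diamond. -/
def IsDiamond {n : ℕ} (A B C D : Entry n) : Prop :=
  LowerLeft A B ∧ LowerRight A C ∧ LowerRight B D ∧ LowerLeft C D

/-- A zig-zag: one entry in each of the rows `2, …, n - 2`, the entry in each row being adjacent
(on the left or on the right, arbitrarily) to the one in the row above. -/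
structure ZigZag (n : ℕ) where
  entry : Fin (n - 3) → Entry n
  row_entry : ∀ m, (entry m).row = (m : ℤ) + 2
  step : ∀ m m' : Fin (n - 3), (m' : ℕ) = m + 1 →
    LowerLeft (entry m) (entry m') ∨ LowerRight (entry m) (entry m')

/-- The field of rational functions in `n - 3` variables over `k`. -/
abbrev RationalFn (k : Type*) [Field k] (n : ℕ) : Type _ :=
  FractionRing (MvPolynomial (Fin (n - 3)) k)

/-- The formal weights, as rational functions. -/
def formalVar (k : Type*) [Field k] (n : ℕ) (m : Fin (n - 3)) : RationalFn k n :=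
  algebraMap (MvPolynomial (Fin (n - 3)) k) (RationalFn k n) (MvPolynomial.X m)

/-- A table whose top and bottom rows consist of 1's, that has the formal weights along the
zig-zag `z`, and that satisfies the frieze relation `A D = B C - 1`. -/
structure IsFriezeTable {k : Type*} [Field k] {n : ℕ} (z : ZigZag n)
    (f : Entry n → RationalFn k n) : Prop where
  top : ∀ p : Entry n, p.row = 1 → f p = 1
  bottom : ∀ p : Entry n, p.row = (n : ℤ) - 1 → f p = 1
  zigzag : ∀ m, f (z.entry m) = formalVar k n m
  frieze : ∀ A B C D : Entry n, IsDiamond A B C D → f A * f D = f B * f C - 1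

/-- Glide-reflection symmetry: row `n - r` is row `r` shifted by `n / 2` to the right. -/
def GlideSymmetric {k : Type*} [Field k] {n : ℕ} (f : Entry n → RationalFn k n) : Prop :=
  ∀ p q : Entry n, q.left = p.right → q.right = p.left + n → f q = f p

/-- Every row has period `n`. -/
def RowPeriodic {k : Type*} [Field k] {n : ℕ} (f : Entry n → RationalFn k n) : Prop :=
  ∀ p q : Entry n, q.left = p.left + n → q.right = p.right + n → f q = f p

/-- A nonzero Laurent polynomial in the formal weights, all of whose nonzero coefficients are
positive integers: `L e` is the coefficient of the Laurent monomial with exponent vector `e`. -/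
def IsPositiveLaurent {k : Type*} [Field k] {n : ℕ} (g : RationalFn k n) : Prop :=
  ∃ L : (Fin (n - 3) → ℤ) →₀ ℕ, L ≠ 0 ∧
    g = L.sum fun e c => (c : RationalFn k n) * ∏ m, formalVar k n m ^ e m

/-! ### Triangulations of the `n`-gon

The vertices of the convex `n`-gon are the elements of `ZMod n` in their cyclic order; a side or a
diagonal is the two-element set of its end points. -/

variable {n : ℕ} [NeZero n]

/-- The sides of the `n`-gon. -/
def sides (n : ℕ) [NeZero n] : Finset (Finset (ZMod n)) := univ.image fun a => {a, a + 1}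

/-- The diagonals `ab` and `cd` cross: `c` and `d` lie strictly on different sides of `ab`. -/
def Cross (e e' : Finset (ZMod n)) : Prop :=
  ∃ a b c d, e = {a, b} ∧ e' = {c, d} ∧ sbtw a c b ∧ sbtw b d a

/-- `T` is the set of diagonals of a triangulation of the convex `n`-gon: it consists of `n - 3`
diagonals, no two of which cross. -/
def IsTriangulation (T : Finset (Finset (ZMod n))) : Prop :=
  T.card = n - 3 ∧ (∀ e ∈ T, e.card = 2 ∧ e ∉ sides n) ∧ ∀ e ∈ T, ∀ e' ∈ T, ¬ Cross e e'

open Classical in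
/-- The triangles of a triangulation with set of diagonals `T`: three vertices that are pairwise
joined by sides or by diagonals in `T`. (As no vertex lies inside such a triangle and diagonals
do not cross, it is a face of the triangulation.) -/
def triangles (T : Finset (Finset (ZMod n))) : Finset (Finset (ZMod n)) :=
  univ.filter fun w => w.card = 3 ∧ ∀ v ∈ w, w.erase v ∈ sides n ∪ T

open Classical in
/-- The edges of the bipartite graph `G_{i,j}`. The black vertices are the vertices of the polygon
other than `i` and `j`, the white vertices are the triangles, and a black vertex is joined to the
triangles of which it is a vertex. -/
def graphEdges (T : Finset (Finset (ZMod n))) (i j : ZMod n) :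
    Finset (ZMod n × Finset (ZMod n)) :=
  univ.filter fun e => e.2 ∈ triangles T ∧ e.1 ∈ e.2 ∧ e.1 ≠ i ∧ e.1 ≠ j

open Classical in
/-- The perfect matchings of `G_{i,j}`, as sets of edges. -/
def perfectMatchings (T : Finset (Finset (ZMod n))) (i j : ZMod n) :
    Finset (Finset (ZMod n × Finset (ZMod n))) :=
  (graphEdges T i j).powerset.filter fun S =>
    (∀ v : ZMod n, v ≠ i → v ≠ j → ∃! e, e ∈ S ∧ e.1 = v) ∧
    (∀ w ∈ triangles T, ∃! e, e ∈ S ∧ e.2 = w)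

/-- The diagonal of the `n`-gon that belongs to the `m`-th entry `(i, j)` of a zig-zag joins the
vertices `i` and `j` modulo `n`. -/
def ZigZag.diagonal (z : ZigZag n) (m : Fin (n - 3)) : Finset (ZMod n) :=
  {((z.entry m).left : ZMod n), ((z.entry m).right : ZMod n)}

/-- The set of diagonals that belong to a zig-zag. -/
def ZigZag.diagonals (z : ZigZag n) : Finset (Finset (ZMod n)) := univ.image z.diagonal

/-- The weight of a side or diagonal: the `m`-th variable for the `m`-th diagonal of the zig-zag,
and `1` (an empty product) for a side. -/
def ZigZag.chordWeight (k : Type*) [Field k] (z : ZigZag n) (e : Finset (ZMod n)) :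
    MvPolynomial (Fin (n - 3)) k :=
  ∏ m with z.diagonal m = e, MvPolynomial.X m

/-- The polynomial `W_{i,j}`: the sum over the perfect matchings of `G_{i,j}` of the product of the
edge weights, where the edge joining the vertex `v` to the triangle `w` has the weight of the side
of `w` opposite to `v`. -/
def ZigZag.matchingSum (k : Type*) [Field k] (z : ZigZag n) (i j : ZMod n) :
    MvPolynomial (Fin (n - 3)) k :=
  ∑ S ∈ perfectMatchings z.diagonals i j, ∏ e ∈ S, z.chordWeight k (e.2.erase e.1)

end FriezeTable

end

open FriezeTable

namespace FriezeTable

/-! The table is a table of 2×2 determinants. Extend the zig-zag to a nested sequence of integer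
intervals, the `m`-th of length `m`, each enlarged by one point at the left or at the right. Over
the field of rational functions, vectors `v i` of the plane are attached to these points one at a
time, so that consecutive vectors have determinant `1` and the ends of the `m`-th interval have the
prescribed weight (`IsStaircase.exists_realizes`). This gives `n` vectors; continue them
antiperiodically, `v (i + n) = -v i`. The frieze relation is the three-term Plücker relation with
two determinants equal to `1` (`isFriezeTable_tableOf`), and the glide reflection and the period
follow from antiperiodicity.

When an interval grows, the same Plücker relation expresses each new determinant through old ones by
additions, multiplications by weights and divisions by weights only (`Realizes.induction`). Hence
every entry is a positive Laurent polynomial. Evaluation at `1` shows that no entry vanishes, so the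
frieze relation can be solved outwards from the zig-zag, which yields uniqueness
(`IsFriezeTable.eq_of_ne_zero`).

Each enlargement also glues a triangle to a subpolygon along a chord. Under this gluing the matching
sums obey the recursion that Ptolemy's relation gives for the determinants, up to one more factor,
the weight of the chord (`incidenceSum_glue`). Induction from a single side gives the matching
formula (`IsStaircase.incidenceSum_eq`), the accumulated factors being the product of the variables.
-/

/-! ### Matching sums of incidence graphs and gluing of triangles -/

open Classical in
/-- The perfect matchings, as sets of edges, of the incidence graph between a set `V` of points and
a set `U` of sets of points. -/
noncomputable def incidenceMatchings {α : Type*} (V : Finset α) (U : Finset (Finset α)) :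
    Finset (Finset (α × Finset α)) :=
  (V ×ˢ U).powerset.filter fun S =>
    (∀ e ∈ S, e.1 ∈ e.2) ∧ (∀ v ∈ V, ∃! e, e ∈ S ∧ e.1 = v) ∧ ∀ w ∈ U, ∃! e, e ∈ S ∧ e.2 = w

theorem mem_incidenceMatchings {α : Type*} {V : Finset α} {U : Finset (Finset α)}
    {S : Finset (α × Finset α)} :
    S ∈ incidenceMatchings V U ↔ (∀ e ∈ S, e.1 ∈ V ∧ e.2 ∈ U ∧ e.1 ∈ e.2) ∧
      (∀ v ∈ V, ∃! e, e ∈ S ∧ e.1 = v) ∧ ∀ w ∈ U, ∃! e, e ∈ S ∧ e.2 = w := by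
  classical
  simp only [incidenceMatchings, mem_filter, mem_powerset, subset_iff, mem_product]
  grind

/-- The sum over the perfect matchings of the products of the edge weights. -/
noncomputable def incidenceSum {α R : Type*} [CommSemiring R] (wt : α × Finset α → R) (V : Finset α)
    (U : Finset (Finset α)) : R :=
  ∑ S ∈ incidenceMatchings V U, ∏ e ∈ S, wt e

/-- Allowing arbitrary sets of points and triangles makes an induction over subpolygons possible;
the graph of the full `n`-gon is the last stage. -/
theorem perfectMatchings_eq {n : ℕ} [NeZero n] (T : Finset (Finset (ZMod n))) (i j : ZMod n) :
    perfectMatchings T i j = incidenceMatchings ((univ.erase i).erase j) (triangles T) := by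
  classical
  ext S
  simp only [mem_incidenceMatchings, perfectMatchings, mem_filter, mem_powerset, subset_iff,
    graphEdges, mem_univ, true_and, mem_erase, and_true, and_imp]
  constructor
  · rintro ⟨h1, h2, h3⟩
    exact ⟨fun e he => by have := h1 he; tauto, fun v hj hi => h2 v hi hj, h3⟩
  · rintro ⟨h1, h2, h3⟩
    exact ⟨fun e he => by have := h1 e he; tauto, fun v hi hj => h2 v hj hi, h3⟩

theorem incidenceSum_empty {α R : Type*} [CommSemiring R] (wt : α × Finset α → R) :
    incidenceSum wt (∅ : Finset α) ∅ = 1 := by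
  have : incidenceMatchings (∅ : Finset α) ∅ = {∅} := by
    ext S
    simp only [mem_incidenceMatchings, notMem_empty, mem_singleton, eq_empty_iff_forall_notMem]
    grind
  simp [incidenceSum, this]

theorem incidenceSum_eq_zero {α R : Type*} [CommSemiring R] (wt : α × Finset α → R)
    {V : Finset α} {U : Finset (Finset α)} {u : α} (hu : u ∈ V) (hU : ∀ t ∈ U, u ∉ t) :
    incidenceSum wt V U = 0 := by
  have : incidenceMatchings V U = ∅ := by
    refine eq_empty_iff_forall_notMem.2 fun S hS => ?_
    obtain ⟨h1, h2, -⟩ := mem_incidenceMatchings.1 hS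
    obtain ⟨e, ⟨he, rfl⟩, -⟩ := h2 u hu
    exact hU _ (h1 e he).2.1 (h1 e he).2.2
  simp [incidenceSum, this]

section

variable {α R : Type*} [DecidableEq α] [CommSemiring R] (wt : α × Finset α → R)
  {V : Finset α} {U : Finset (Finset α)} {u : α} {w : Finset α}

/-- Together with `erase_mem_incidenceMatchings` this is the bijection behind the expansion along
`w`: a matching is determined by the partner `v` of `w` and a matching of what remains. -/
theorem insert_mem_incidenceMatchings {v : α} (hw : w ∉ U) (hv : v ∈ V) (hvw : v ∈ w)
    {S : Finset (α × Finset α)} (hS : S ∈ incidenceMatchings (V.erase v) U) :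
    insert (v, w) S ∈ incidenceMatchings V (insert w U) := by
  obtain ⟨h1, h2, h3⟩ := mem_incidenceMatchings.1 hS
  refine mem_incidenceMatchings.2 ⟨?_, ?_, ?_⟩
  · intro e he
    rcases mem_insert.1 he with rfl | he
    · exact ⟨hv, mem_insert_self _ _, hvw⟩
    · have := h1 e he
      exact ⟨mem_of_mem_erase this.1, mem_insert_of_mem this.2.1, this.2.2⟩
  · intro x hx
    by_cases hxv : x = v
    · subst hxv
      refine ⟨(x, w), ⟨mem_insert_self _ _, rfl⟩, ?_⟩
      rintro e ⟨he, hex⟩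
      rcases mem_insert.1 he with rfl | he
      · rfl
      · exact absurd hex (ne_of_mem_erase (h1 e he).1)
    · obtain ⟨e, ⟨he, hex⟩, huniq⟩ := h2 x (mem_erase.2 ⟨hxv, hx⟩)
      refine ⟨e, ⟨mem_insert_of_mem he, hex⟩, ?_⟩
      rintro e' ⟨he', hex'⟩
      rcases mem_insert.1 he' with rfl | he'
      · exact absurd hex'.symm hxv
      · exact huniq _ ⟨he', hex'⟩
  · intro x hx
    by_cases hxw : x = w
    · subst hxw
      refine ⟨(v, x), ⟨mem_insert_self _ _, rfl⟩, ?_⟩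
      rintro e ⟨he, rfl⟩
      rcases mem_insert.1 he with h | he
      · exact h
      · exact absurd (h1 e he).2.1 hw
    · obtain ⟨e, ⟨he, hex⟩, huniq⟩ := h3 x ((mem_insert.1 hx).resolve_left hxw)
      refine ⟨e, ⟨mem_insert_of_mem he, hex⟩, ?_⟩
      rintro e' ⟨he', hex'⟩
      rcases mem_insert.1 he' with rfl | he'
      · exact absurd hex'.symm hxw
      · exact huniq _ ⟨he', hex'⟩

theorem erase_mem_incidenceMatchings {v : α} (hw : w ∉ U) {S : Finset (α × Finset α)}
    (hS : S ∈ incidenceMatchings V (insert w U)) (hv : (v, w) ∈ S) :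
    S.erase (v, w) ∈ incidenceMatchings (V.erase v) U := by
  obtain ⟨h1, h2, h3⟩ := mem_incidenceMatchings.1 hS
  have hv' := h1 _ hv
  have key1 : ∀ e ∈ S, e.1 = v → e = (v, w) := fun e he hev =>
    (h2 v hv'.1).unique ⟨he, hev⟩ ⟨hv, rfl⟩
  have key2 : ∀ e ∈ S, e.2 = w → e = (v, w) := fun e he hev =>
    (h3 w (mem_insert_self _ _)).unique ⟨he, hev⟩ ⟨hv, rfl⟩
  refine mem_incidenceMatchings.2 ⟨?_, ?_, ?_⟩
  · intro e he
    obtain ⟨hne, he⟩ := mem_erase.1 he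
    have := h1 e he
    exact ⟨mem_erase.2 ⟨fun h => hne (key1 e he h), this.1⟩,
      (mem_insert.1 this.2.1).resolve_left fun h => hne (key2 e he h), this.2.2⟩
  · intro x hx
    obtain ⟨hxv, hx⟩ := mem_erase.1 hx
    obtain ⟨e, ⟨he, rfl⟩, huniq⟩ := h2 x hx
    exact ⟨e, ⟨mem_erase.2 ⟨fun h => hxv (by rw [h]), he⟩, rfl⟩,
      fun e' he' => huniq e' ⟨mem_of_mem_erase he'.1, he'.2⟩⟩
  · intro x hx
    obtain ⟨e, ⟨he, rfl⟩, huniq⟩ := h3 x (mem_insert_of_mem hx)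
    exact ⟨e, ⟨mem_erase.2 ⟨fun h => hw (by rw [h] at hx; exact hx), he⟩, rfl⟩,
      fun e' he' => huniq e' ⟨mem_of_mem_erase he'.1, he'.2⟩⟩

/-- Expansion of the matching sum along one of the sets. -/
theorem incidenceSum_insert (hw : w ∉ U) :
    incidenceSum wt V (insert w U) =
      ∑ v ∈ V with v ∈ w, wt (v, w) * incidenceSum wt (V.erase v) U := by
  have hnot : ∀ v v' S, S ∈ incidenceMatchings (V.erase v) U → (v', w) ∉ S := fun v v' S hS h =>
    hw ((mem_incidenceMatchings.1 hS).1 _ h).2.1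
  simp only [incidenceSum, mul_sum]
  rw [Finset.sum_sigma']
  symm
  refine Finset.sum_bij (fun x _ => insert (x.1, w) x.2) ?_ ?_ ?_ ?_
  · rintro ⟨v, S⟩ hx
    simp only [mem_sigma, mem_filter] at hx
    exact insert_mem_incidenceMatchings hw hx.1.1 hx.1.2 hx.2
  · rintro ⟨v, S⟩ hx ⟨v', S'⟩ hx' h
    simp only [mem_sigma, mem_filter] at hx hx' h
    have hv : v = v' := by
      have : (v, w) ∈ insert (v', w) S' := h ▸ mem_insert_self _ _
      rcases mem_insert.1 this with h | h
      · exact congrArg Prod.fst h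
      · exact absurd h (hnot _ _ _ hx'.2)
    subst hv
    have : S = S' := by
      rw [← erase_insert (hnot _ v _ hx.2), h, erase_insert (hnot _ v _ hx'.2)]
    rw [this]
  · intro S hS
    obtain ⟨h1, -, h3⟩ := mem_incidenceMatchings.1 hS
    obtain ⟨⟨v, w'⟩, ⟨he, rfl⟩, -⟩ := h3 w (mem_insert_self _ _)
    have := h1 _ he
    exact ⟨⟨v, S.erase (v, w')⟩,
      mem_sigma.2 ⟨mem_filter.2 ⟨this.1, this.2.2⟩, erase_mem_incidenceMatchings hw hS he⟩,
      insert_erase he⟩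
  · rintro ⟨v, S⟩ hx
    simp only [mem_sigma, mem_filter] at hx
    rw [prod_insert (hnot _ _ _ hx.2)]

/-- A point that lies in only one of the sets is matched with that set. -/
theorem incidenceSum_insert_insert (hw : w ∉ U) (hu : u ∉ V) (huw : u ∈ w)
    (hU : ∀ t ∈ U, u ∉ t) :
    incidenceSum wt (insert u V) (insert w U) = wt (u, w) * incidenceSum wt V U := by
  rw [incidenceSum_insert wt hw, Finset.sum_eq_single u]
  · rw [erase_insert hu]
  · intro v _ hvu
    rw [incidenceSum_eq_zero wt (mem_erase.2 ⟨hvu.symm, mem_insert_self u V⟩) hU, mul_zero]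
  · intro h
    exact absurd (mem_filter.2 ⟨mem_insert_self u V, huw⟩) h

end

/-- Gluing a triangle `a b u` with a new vertex `u` to a polygon with vertex set `V`, along the
chord `a b`: if the matching sums of the polygon are proportional to `Q`, and `Q` satisfies
Ptolemy's relation, then so are the matching sums of the larger polygon. -/
theorem incidenceSum_glue {α K : Type*} [DecidableEq α] [Field K] {V : Finset α}
    {U : Finset (Finset α)} {a b u : α} (c : Finset α → K) (Q : α → α → K) (P : K)
    (hsymm : ∀ x y, Q x y = Q y x)
    (ha : a ∈ V) (hb : b ∈ V) (hab : a ≠ b) (hu : u ∉ V) (hU : ∀ t ∈ U, u ∉ t)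
    (hcab : c {a, b} = Q a b) (hcau : c {a, u} = Q a u) (hcbu : c {b, u} = Q b u)
    (hptolemy : ∀ i ∈ V, Q i u * Q a b = Q a u * Q i b + Q b u * Q i a)
    (ih : ∀ i ∈ V, ∀ j ∈ V, i ≠ j →
      incidenceSum (fun e => c (e.2.erase e.1)) ((V.erase i).erase j) U = Q i j * P) :
    ∀ i ∈ insert u V, ∀ j ∈ insert u V, i ≠ j →
      incidenceSum (fun e => c (e.2.erase e.1)) (((insert u V).erase i).erase j)
        (insert {a, b, u} U) = Q i j * (P * Q a b) := by
  have hau : a ≠ u := fun h => hu (h ▸ ha)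
  have hbu : b ≠ u := fun h => hu (h ▸ hb)
  have hw : ({a, b, u} : Finset α) ∉ U := fun h => hU _ h (by simp)
  have e1 : ({a, b, u} : Finset α).erase u = {a, b} := by grind
  have e2 : ({a, b, u} : Finset α).erase a = {b, u} := by grind
  have e3 : ({a, b, u} : Finset α).erase b = {a, u} := by grind
  set wt : α × Finset α → K := fun e => c (e.2.erase e.1) with hwt
  -- If `u` is one of the two omitted points, the new triangle must be matched with `a` or `b`. The
  -- two resulting terms are the right-hand side of Ptolemy's relation times `P`; if `i` is itself
  -- `a` or `b`, only one term survives.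
  have hnew : ∀ i ∈ V, incidenceSum wt (V.erase i) (insert {a, b, u} U) = Q i u * (P * Q a b) := by
    intro i hi
    rw [incidenceSum_insert wt hw]
    have hval : ∀ v ∈ V, v ≠ i →
        incidenceSum wt ((V.erase i).erase v) U = Q i v * P := fun v hv hvi =>
      ih i hi v hv hvi.symm
    have wa : wt (a, {a, b, u}) = Q b u := by simp only [hwt, e2, hcbu]
    have wb : wt (b, {a, b, u}) = Q a u := by simp only [hwt, e3, hcau]
    have hp := hptolemy i hi
    by_cases hia : i = a
    · subst hia
      have : (V.erase i).filter (· ∈ ({i, b, u} : Finset α)) = {b} := by grind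
      rw [this, sum_singleton, hval b hb hab.symm, wb]
      ring
    by_cases hib : i = b
    · subst hib
      have : (V.erase i).filter (· ∈ ({a, i, u} : Finset α)) = {a} := by grind
      rw [this, sum_singleton, hval a ha hab, wa, hsymm i a]
      ring
    have : (V.erase i).filter (· ∈ ({a, b, u} : Finset α)) = {a, b} := by grind
    rw [this, sum_pair hab, hval a ha (Ne.symm hia), hval b hb (Ne.symm hib), wa, wb]
    linear_combination (-P) * hp
  intro i hi j hj hij
  by_cases hju : j = u
  · subst hju
    have hi' : i ∈ V := (mem_insert.1 hi).resolve_left hij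
    rw [show ((insert j V).erase i).erase j = V.erase i by grind, hnew i hi']
  by_cases hiu : i = u
  · subst hiu
    have hj' : j ∈ V := (mem_insert.1 hj).resolve_left hju
    rw [erase_insert hu, hnew j hj', hsymm]
  have hi' : i ∈ V := (mem_insert.1 hi).resolve_left hiu
  have hj' : j ∈ V := (mem_insert.1 hj).resolve_left hju
  -- If `u` is not omitted, it lies in no triangle but the new one, so that edge is forced and
  -- contributes the weight of the gluing chord.
  rw [show ((insert u V).erase i).erase j = insert u ((V.erase i).erase j) by grind,
    incidenceSum_insert_insert wt hw (by grind) (by simp) hU, ih i hi' j hj' hij]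
  simp only [hwt, e1, hcab]
  ring

/-! ### Staircases of intervals and the triangulations they define -/

/-- The left end points of a growing sequence of integer intervals, the `m`-th one of length `m`. -/
def IsStaircase (L : ℕ → ℤ) : Prop := ∀ m, L (m + 1) = L m ∨ L (m + 1) = L m - 1

theorem IsStaircase.nested {L : ℕ → ℤ} (hL : IsStaircase L) {m k : ℕ} (h : m ≤ k) :
    L k ≤ L m ∧ L m + m ≤ L k + k := by
  induction k, h using Nat.le_induction with
  | base => simp
  | succ k _ ih =>
    push_cast
    rcases hL k with h | h <;> rw [h] <;> omega

/-- The chord joining the end points of the `m`-th interval. -/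
def chord (n : ℕ) (L : ℕ → ℤ) (m : ℕ) : Finset (ZMod n) :=
  {(L m : ZMod n), ((L m + m : ℤ) : ZMod n)}

/-- The triangle between two consecutive chords. -/
def stairTriangle (n : ℕ) (L : ℕ → ℤ) (m : ℕ) : Finset (ZMod n) :=
  chord n L m ∪ chord n L (m + 1)

/-- The point by which the `m`-th interval is enlarged. -/
def newVertex (L : ℕ → ℤ) (m : ℕ) : ℤ := if L (m + 1) = L m then L m + m + 1 else L m - 1

/-- A window of `n` consecutive integers represents each vertex exactly once, so statements about
vertices turn into linear arithmetic over the integers. -/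
theorem cast_inj_of_window {n : ℕ} {A x y : ℤ} (hx : A ≤ x) (hx' : x < A + n) (hy : A ≤ y)
    (hy' : y < A + n) : (x : ZMod n) = y ↔ x = y := by
  refine ⟨fun h => ?_, fun h => h ▸ rfl⟩
  have := (ZMod.intCast_eq_intCast_iff_dvd_sub x y n).1 h
  have := Int.eq_zero_of_abs_lt_dvd this (abs_lt.2 ⟨by omega, by omega⟩)
  omega

theorem exists_cast_window {n : ℕ} [NeZero n] (A : ℤ) (x : ZMod n) :
    ∃ i : ℤ, A ≤ i ∧ i < A + n ∧ (i : ZMod n) = x := by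
  have hn : (0 : ℤ) < n := by exact_mod_cast Nat.pos_of_ne_zero (NeZero.ne n)
  refine ⟨A + ((x.val : ℤ) - A) % n, ?_, ?_, ?_⟩
  · have := Int.emod_nonneg ((x.val : ℤ) - A) hn.ne'
    omega
  · have := Int.emod_lt_of_pos ((x.val : ℤ) - A) hn
    omega
  · simp

theorem pair_inj_of_window {n : ℕ} {A a c a' c' : ℤ} (ha : A ≤ a) (hac : a < c) (hc : c < A + n)
    (ha' : A ≤ a') (hac' : a' < c') (hc' : c' < A + n) :
    ({(a : ZMod n), (c : ZMod n)} : Finset (ZMod n)) = {(a' : ZMod n), (c' : ZMod n)} ↔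
      a = a' ∧ c = c' := by
  refine ⟨fun h => ?_, fun ⟨h, h'⟩ => by rw [h, h']⟩
  have h1 : (a : ZMod n) ∈ ({(a' : ZMod n), (c' : ZMod n)} : Finset (ZMod n)) := by
    rw [← h]; simp
  have h2 : (c : ZMod n) ∈ ({(a' : ZMod n), (c' : ZMod n)} : Finset (ZMod n)) := by
    rw [← h]; simp
  simp only [mem_insert, mem_singleton] at h1 h2
  rw [cast_inj_of_window (by omega) (by omega) ha' (by omega : a' < A + n),
    cast_inj_of_window (by omega) (by omega) (by omega : A ≤ c') hc'] at h1 h2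
  omega

/-- The second alternative is the side that closes up the polygon, from the last point of the window
back to the first. -/
theorem pair_mem_sides {n : ℕ} [NeZero n] (hn : 3 ≤ n) {A a c : ℤ} (ha : A ≤ a) (hac : a < c)
    (hc : c < A + n) :
    ({(a : ZMod n), (c : ZMod n)} : Finset (ZMod n)) ∈ sides n ↔
      c = a + 1 ∨ (a = A ∧ c = A + n - 1) := by
  simp only [sides, mem_image, mem_univ, true_and]
  constructor
  · rintro ⟨x, hx⟩
    obtain ⟨i, hi, hi', rfl⟩ := exists_cast_window A x
    by_cases h : i + 1 < A + n
    · rw [← Int.cast_one, ← Int.cast_add,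
        pair_inj_of_window hi (by omega) h ha hac hc] at hx
      omega
    · have e : ((i : ZMod n) + 1) = (A : ZMod n) := by
        rw [show i = A + n - 1 by omega]; simp
      rw [e, Finset.pair_comm, pair_inj_of_window le_rfl (by omega) hi' ha hac hc] at hx
      omega
  · rintro (rfl | ⟨rfl, rfl⟩)
    · exact ⟨a, by simp⟩
    · exact ⟨((a + n - 1 : ℤ) : ZMod n), by rw [Finset.pair_comm]; simp⟩

section

variable {n : ℕ} {L : ℕ → ℤ} (hL : IsStaircase L)

include hL

theorem IsStaircase.window {m : ℕ} (hm : m + 1 ≤ n) :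
    L (n - 1) ≤ L m ∧ L m + m < L (n - 1) + n := by
  have := hL.nested (show m ≤ n - 1 by omega)
  have : ((n - 1 : ℕ) : ℤ) = n - 1 := by omega
  omega

theorem IsStaircase.chord_succ (m : ℕ) :
    (newVertex L m = L m + m + 1 ∧ L (m + 1) = L m ∧
      chord n L (m + 1) = {(L m : ZMod n), (newVertex L m : ZMod n)}) ∨
    (newVertex L m = L m - 1 ∧ L (m + 1) = L m - 1 ∧
      chord n L (m + 1) = {(newVertex L m : ZMod n), ((L m + m : ℤ) : ZMod n)}) := by
  rcases hL m with h | h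
  · left
    have hu : newVertex L m = L m + m + 1 := by simp [newVertex, h]
    refine ⟨hu, h, ?_⟩
    rw [hu, chord, h]
    push_cast
    rw [add_assoc]
  · right
    have hu : newVertex L m = L m - 1 := by simp [newVertex, h]
    refine ⟨hu, h, ?_⟩
    rw [hu, chord, h]
    push_cast
    rw [sub_add_add_cancel]

theorem IsStaircase.stairTriangle_eq (m : ℕ) :
    stairTriangle n L m =
      {(L m : ZMod n), ((L m + m : ℤ) : ZMod n), (newVertex L m : ZMod n)} := by
  rcases hL.chord_succ (n := n) m with ⟨-, -, h⟩ | ⟨-, -, h⟩ <;> rw [stairTriangle, h, chord] <;>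
    grind

theorem IsStaircase.newVertex_window {m : ℕ} (hm : m + 1 < n) :
    L (n - 1) ≤ newVertex L m ∧ newVertex L m < L (n - 1) + n := by
  have h1 := hL.window (n := n) (m := m) (by omega)
  have h2 := hL.window (n := n) (m := m + 1) (by omega)
  rcases hL.chord_succ (n := n) m with ⟨h, h', -⟩ | ⟨h, h', -⟩ <;> rw [h] <;> push_cast at h2 <;>
    omega

theorem IsStaircase.chord_injOn : Set.InjOn (chord n L) (Ico 1 n : Finset ℕ) := by
  intro m hm m' hm' h
  rw [coe_Ico, Set.mem_Ico] at hm hm'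
  have h1 := hL.window (n := n) (m := m) (by omega)
  have h2 := hL.window (n := n) (m := m') (by omega)
  have := (pair_inj_of_window h1.1 (by omega) h1.2 h2.1 (by omega) h2.2).1 h
  omega

/-- The range of `m` includes `n - 1`: the closing side is itself the last chord of the staircase,
so it needs no case of its own. -/
theorem IsStaircase.pair_mem_sides_union [NeZero n] (hn : 3 ≤ n) {a c : ℤ} (ha : L (n - 1) ≤ a)
    (hac : a < c) (hc : c < L (n - 1) + n) :
    ({(a : ZMod n), (c : ZMod n)} : Finset (ZMod n)) ∈
        sides n ∪ (Ico 2 (n - 1)).image (chord n L) ↔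
      c = a + 1 ∨ ∃ m, 2 ≤ m ∧ m ≤ n - 1 ∧ a = L m ∧ c = L m + m := by
  rw [mem_union, pair_mem_sides hn ha hac hc, mem_image]
  have key : ∀ m : ℕ, 2 ≤ m → m ≤ n - 1 →
      (chord n L m = {(a : ZMod n), (c : ZMod n)} ↔ a = L m ∧ c = L m + m) := by
    intro m h2 hm
    have := hL.window (n := n) (m := m) (by omega)
    rw [chord, pair_inj_of_window this.1 (by omega) this.2 ha hac hc]
    omega
  constructor
  · rintro ((h | h) | ⟨m, hm, h⟩)
    · exact Or.inl h
    · exact Or.inr ⟨n - 1, by omega, le_rfl, h.1, by omega⟩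
    · rw [mem_Ico] at hm
      exact Or.inr ⟨m, hm.1, hm.2.le, (key m hm.1 hm.2.le).1 h⟩
  · rintro (h | ⟨m, h2, hm, h⟩)
    · exact Or.inl (Or.inl h)
    · by_cases h' : m = n - 1
      · subst h'
        exact Or.inl (Or.inr ⟨h.1, by omega⟩)
      · exact Or.inr ⟨m, mem_Ico.2 ⟨h2, by omega⟩, (key m h2 hm).2 h⟩

end

theorem exists_sorted_of_card_three {n : ℕ} [NeZero n] (A : ℤ) {w : Finset (ZMod n)}
    (hw : w.card = 3) : ∃ a b c : ℤ, A ≤ a ∧ a < b ∧ b < c ∧ c < A + n ∧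
      w = {(a : ZMod n), (b : ZMod n), (c : ZMod n)} := by
  obtain ⟨x, y, z, hxy, hxz, hyz, rfl⟩ := card_eq_three.1 hw
  obtain ⟨i, hi, hi', rfl⟩ := exists_cast_window A x
  obtain ⟨j, hj, hj', rfl⟩ := exists_cast_window A y
  obtain ⟨k, hk, hk', rfl⟩ := exists_cast_window A z
  rw [Ne, cast_inj_of_window (by assumption) (by assumption) (by assumption) (by assumption)]
    at hxy hxz hyz
  rcases lt_or_gt_of_ne hxy with h1 | h1 <;> rcases lt_or_gt_of_ne hxz with h2 | h2 <;>
    rcases lt_or_gt_of_ne hyz with h3 | h3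
  · exact ⟨i, j, k, hi, h1, h3, hk', rfl⟩
  · exact ⟨i, k, j, hi, h2, h3, hj', by grind⟩
  · omega
  · exact ⟨k, i, j, hk, h2, h1, hj', by grind⟩
  · exact ⟨j, i, k, hj, h1, h2, hk', by grind⟩
  · omega
  · exact ⟨j, k, i, hj, h3, h2, hi', by grind⟩
  · exact ⟨k, j, i, hk, h3, h1, hi', by grind⟩

section

variable {n : ℕ} [NeZero n] {L : ℕ → ℤ} (hL : IsStaircase L)

include hL

theorem IsStaircase.stairTriangle_mem_triangles (hn : 3 ≤ n) {m : ℕ} (h1 : 1 ≤ m)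
    (hm : m + 1 < n) :
    stairTriangle n L m ∈ triangles ((Ico 2 (n - 1)).image (chord n L)) := by
  have hw := hL.window (n := n) (m := m) (by omega)
  have hu := hL.newVertex_window (m := m) hm
  have hm0 : (1 : ℤ) ≤ m := by exact_mod_cast h1
  simp only [triangles, mem_filter, mem_univ, true_and]
  have hpair : ∀ a c : ℤ, L (n - 1) ≤ a → a < c → c < L (n - 1) + n →
      (c = a + 1 ∨ ∃ k, 2 ≤ k ∧ k ≤ n - 1 ∧ a = L k ∧ c = L k + k) →
      ({(a : ZMod n), (c : ZMod n)} : Finset (ZMod n)) ∈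
        sides n ∪ (Ico 2 (n - 1)).image (chord n L) := fun a c h1 h2 h3 h4 =>
    (hL.pair_mem_sides_union hn h1 h2 h3).2 h4
  have hbase : L m + m = L m + 1 ∨
      ∃ k, 2 ≤ k ∧ k ≤ n - 1 ∧ L m = L k ∧ L m + m = L k + k := by
    rcases h1.eq_or_lt with h | h
    · left; rw [← h]; simp
    · exact Or.inr ⟨m, h, by omega, rfl, rfl⟩
  have ha := hpair (L m) (L m + m) hw.1 (by omega) hw.2 hbase
  rw [hL.stairTriangle_eq]
  rcases hL.chord_succ (n := n) m with ⟨h, h', -⟩ | ⟨h, h', -⟩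
  · have hb := hpair (L m) (newVertex L m) hw.1 (by omega) hu.2
      (Or.inr ⟨m + 1, by omega, by omega, by omega, by push_cast; omega⟩)
    have hc := hpair (L m + m) (newVertex L m) (by omega) (by omega) hu.2 (Or.inl (by omega))
    have n1 : (L m : ZMod n) ≠ ((L m + m : ℤ) : ZMod n) := by
      rw [Ne, cast_inj_of_window (A := L (n - 1))] <;> omega
    have n2 : (L m : ZMod n) ≠ (newVertex L m : ZMod n) := by
      rw [Ne, cast_inj_of_window (A := L (n - 1))] <;> omega
    have n3 : ((L m + m : ℤ) : ZMod n) ≠ (newVertex L m : ZMod n) := by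
      rw [Ne, cast_inj_of_window (A := L (n - 1))] <;> omega
    generalize (L m : ZMod n) = x at *
    generalize ((L m + m : ℤ) : ZMod n) = y at *
    generalize (newVertex L m : ZMod n) = t at *
    refine ⟨card_eq_three.2 ⟨x, y, t, n1, n2, n3, rfl⟩, ?_⟩
    intro v hv
    have e1 : ({x, y, t} : Finset (ZMod n)).erase x = {y, t} := by grind
    have e2 : ({x, y, t} : Finset (ZMod n)).erase y = {x, t} := by grind
    have e3 : ({x, y, t} : Finset (ZMod n)).erase t = {x, y} := by grind
    simp only [mem_insert, mem_singleton] at hv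
    rcases hv with rfl | rfl | rfl
    · rw [e1]; convert hc
    · rw [e2]; convert hb
    · rw [e3]; convert ha
  · have hb := hpair (newVertex L m) (L m) hu.1 (by omega) (by omega) (Or.inl (by omega))
    have hc := hpair (newVertex L m) (L m + m) hu.1 (by omega) (by omega)
      (Or.inr ⟨m + 1, by omega, by omega, by omega, by push_cast; omega⟩)
    have n1 : (L m : ZMod n) ≠ ((L m + m : ℤ) : ZMod n) := by
      rw [Ne, cast_inj_of_window (A := L (n - 1))] <;> omega
    have n2 : (L m : ZMod n) ≠ (newVertex L m : ZMod n) := by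
      rw [Ne, cast_inj_of_window (A := L (n - 1))] <;> omega
    have n3 : ((L m + m : ℤ) : ZMod n) ≠ (newVertex L m : ZMod n) := by
      rw [Ne, cast_inj_of_window (A := L (n - 1))] <;> omega
    generalize (L m : ZMod n) = x at *
    generalize ((L m + m : ℤ) : ZMod n) = y at *
    generalize (newVertex L m : ZMod n) = t at *
    refine ⟨card_eq_three.2 ⟨x, y, t, n1, n2, n3, rfl⟩, ?_⟩
    intro v hv
    have e1 : ({x, y, t} : Finset (ZMod n)).erase x = {t, y} := by grind
    have e2 : ({x, y, t} : Finset (ZMod n)).erase y = {t, x} := by grind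
    have e3 : ({x, y, t} : Finset (ZMod n)).erase t = {x, y} := by grind
    simp only [mem_insert, mem_singleton] at hv
    rcases hv with rfl | rfl | rfl
    · rw [e1]; convert hc
    · rw [e2]; convert hb
    · rw [e3]; convert ha

/-- For a triangle `a < b < c` in the window, the long side `a c` must be a chord of the staircase,
of length `M` say. One short side is a polygon side and the other is then the chord of length `M -
1`, which leaves the triangle between these two consecutive chords. -/
theorem IsStaircase.triangles_eq (hn : 3 ≤ n) :
    triangles ((Ico 2 (n - 1)).image (chord n L)) =
      (Ico 1 (n - 1)).image (stairTriangle n L) := by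
  ext w
  constructor
  · intro hw
    simp only [triangles, mem_filter, mem_univ, true_and] at hw
    obtain ⟨hcard, hside⟩ := hw
    obtain ⟨a, b, c, ha, hab, hbc, hc, rfl⟩ := exists_sorted_of_card_three (L (n - 1)) hcard
    have nab : (a : ZMod n) ≠ (b : ZMod n) := by
      rw [Ne, cast_inj_of_window (A := L (n - 1))] <;> omega
    have nac : (a : ZMod n) ≠ (c : ZMod n) := by
      rw [Ne, cast_inj_of_window (A := L (n - 1))] <;> omega
    have nbc : (b : ZMod n) ≠ (c : ZMod n) := by
      rw [Ne, cast_inj_of_window (A := L (n - 1))] <;> omega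
    have sbc := hside (a : ZMod n) (by simp)
    have sac := hside (b : ZMod n) (by simp)
    have sab := hside (c : ZMod n) (by simp)
    rw [show ({(a : ZMod n), (b : ZMod n), (c : ZMod n)} : Finset (ZMod n)).erase (a : ZMod n) =
      {(b : ZMod n), (c : ZMod n)} by grind] at sbc
    rw [show ({(a : ZMod n), (b : ZMod n), (c : ZMod n)} : Finset (ZMod n)).erase (b : ZMod n) =
      {(a : ZMod n), (c : ZMod n)} by grind] at sac
    rw [show ({(a : ZMod n), (b : ZMod n), (c : ZMod n)} : Finset (ZMod n)).erase (c : ZMod n) =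
      {(a : ZMod n), (b : ZMod n)} by grind] at sab
    have sbc := (hL.pair_mem_sides_union hn (by omega) hbc hc).1 (by convert sbc)
    have sac := (hL.pair_mem_sides_union hn ha (by omega) hc).1 (by convert sac)
    have sab := (hL.pair_mem_sides_union hn ha hab (by omega)).1 (by convert sab)
    obtain ⟨M, hM2, hM, haM, hcM⟩ := sac.resolve_left (by omega)
    -- Otherwise both short sides would be staircase chords. Their intervals both contain the first
    -- interval, of length one, yet they meet only in `b`.
    have hb1 : b = a + 1 ∨ c = b + 1 := by
      rcases sab with h | ⟨p, hp2, hp, hp3, hp4⟩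
      · exact Or.inl h
      rcases sbc with h | ⟨q, hq2, hq, hq3, hq4⟩
      · exact Or.inr h
      have h1 := hL.nested (show 1 ≤ p by omega)
      have h2 := hL.nested (show 1 ≤ q by omega)
      omega
    -- The short side left over has length `M - 1`, and there is only one staircase chord of that
    -- length. For `M = 2` it is a polygon side too, and `b` is an end of the first interval.
    have hbM : b = L (M - 1) ∨ b = L (M - 1) + (M - 1 : ℕ) := by
      obtain ⟨N, rfl⟩ : ∃ N, M = N + 1 := ⟨M - 1, by omega⟩
      have hstep := hL N
      simp only [Nat.add_sub_cancel]
      push_cast at hcM ⊢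
      rcases hb1 with h | h
      · rcases sbc with h' | ⟨p, hp2, hp, hp3, hp4⟩
        · omega
        · have hpN : p = N := by omega
          subst hpN; exact Or.inl hp3
      · rcases sab with h' | ⟨p, hp2, hp, hp3, hp4⟩
        · omega
        · have hpN : p = N := by omega
          subst hpN; exact Or.inr hp4
    refine mem_image.2 ⟨M - 1, mem_Ico.2 ⟨by omega, by omega⟩, ?_⟩
    obtain ⟨N, rfl⟩ : ∃ N, M = N + 1 := ⟨M - 1, by omega⟩
    simp only [Nat.add_sub_cancel] at hbM ⊢
    have hstep := hL N
    push_cast at hcM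
    rw [hL.stairTriangle_eq]
    rcases hL.chord_succ (n := n) N with ⟨h, h', -⟩ | ⟨h, h', -⟩
    · have e1 : L N = a := by omega
      have e2 : L N + N = b := by omega
      have e3 : newVertex L N = c := by omega
      rw [e2, e3, e1]
    · have e1 : L N = b := by omega
      have e2 : L N + N = c := by omega
      have e3 : newVertex L N = a := by omega
      rw [e2, e3, e1]
      grind
  · intro hw
    obtain ⟨m, hm, rfl⟩ := mem_image.1 hw
    rw [mem_Ico] at hm
    exact hL.stairTriangle_mem_triangles hn hm.1 (by omega)

/-- Chords over nested intervals cannot cross. The work lies in translating the cyclic order of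
`ZMod n`, defined through representatives in `[0, n)`, to the window. -/
theorem IsStaircase.not_cross {m m' : ℕ} (h1 : 1 ≤ m) (hm : m < n) (h1' : 1 ≤ m') (hm' : m' < n) :
    ¬ Cross (chord n L m) (chord n L m') := by
  have sbtw_val : ∀ x y z : ZMod n, sbtw x y z →
      (x.val < y.val ∧ y.val < z.val) ∨ (y.val < z.val ∧ z.val < x.val) ∨
        (z.val < x.val ∧ x.val < y.val) := by
    cases n with
    | zero => omega
    | succ n => exact fun x y z h => Fin.sbtw_iff.1 h
  have hn : (0 : ℤ) < n := by omega
  -- A window meets at most two blocks `[n * q, n * q + n)`, so the standard representative differs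
  -- from `x` by one of two fixed shifts, a rotation of the order.
  have hval : ∀ x : ℤ, L (n - 1) ≤ x → x < L (n - 1) + n →
      (((x : ZMod n).val : ℤ) = x - n * (L (n - 1) / n) ∧ x < n * (L (n - 1) / n) + n) ∨
      (((x : ZMod n).val : ℤ) = x - n * (L (n - 1) / n) - n ∧ n * (L (n - 1) / n) + n ≤ x) := by
    intro x hx hx'
    have e := ZMod.val_intCast (n := n) x
    have d := Int.mul_ediv_add_emod (L (n - 1)) n
    have d0 := Int.emod_nonneg (L (n - 1)) hn.ne'
    have d1 := Int.emod_lt_of_pos (L (n - 1)) hn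
    rw [e]
    generalize hQ : L (n - 1) / n = q at *
    by_cases hc : x < n * q + n
    · left
      refine ⟨?_, hc⟩
      rw [show x = (x - n * q) + n * q by ring, Int.add_mul_emod_self_left, Int.emod_eq_of_lt] <;>
        omega
    · right
      refine ⟨?_, by omega⟩
      rw [show x = (x - n * q - n) + n * (q + 1) by ring, Int.add_mul_emod_self_left,
        Int.emod_eq_of_lt] <;> linarith
  rintro ⟨a, b, c, d, e1, e2, s1, s2⟩
  have w1 := hL.window (n := n) (m := m) (by omega)
  have w2 := hL.window (n := n) (m := m') (by omega)
  have nest : (L m ≤ L m' ∧ L m' + m' ≤ L m + m) ∨ (L m' ≤ L m ∧ L m + m ≤ L m' + m') := by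
    rcases le_total m m' with h | h
    · exact Or.inr (hL.nested h)
    · exact Or.inl (hL.nested h)
  have pairs : ∀ x y p q : ZMod n, ({x, y} : Finset (ZMod n)) = {p, q} →
      (p = x ∧ q = y) ∨ (p = y ∧ q = x) ∨ p = q := by
    intro x y p q h
    have hp : p ∈ ({x, y} : Finset (ZMod n)) := by rw [h]; simp
    have hq : q ∈ ({x, y} : Finset (ZMod n)) := by rw [h]; simp
    simp only [mem_insert, mem_singleton] at hp hq
    rcases hp with rfl | rfl <;> rcases hq with rfl | rfl <;> simp
  have v1 := hval (L m) w1.1 (by omega)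
  have v2 := hval (L m + m) (by omega) w1.2
  have v3 := hval (L m') w2.1 (by omega)
  have v4 := hval (L m' + m') (by omega) w2.2
  replace s1 := sbtw_val _ _ _ s1
  replace s2 := sbtw_val _ _ _ s2
  generalize (n : ℤ) * (L (n - 1) / n) = Q at *
  have p1 := pairs _ _ _ _ e1
  have p2 := pairs _ _ _ _ e2
  generalize (L m : ZMod n) = x1 at *
  generalize ((L m + m : ℤ) : ZMod n) = x2 at *
  generalize (L m' : ZMod n) = x3 at *
  generalize ((L m' + m' : ℤ) : ZMod n) = x4 at *
  rcases p1 with ⟨rfl, rfl⟩ | ⟨rfl, rfl⟩ | rfl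
  · rcases p2 with ⟨rfl, rfl⟩ | ⟨rfl, rfl⟩ | rfl
    · omega
    · omega
    · omega
  · rcases p2 with ⟨rfl, rfl⟩ | ⟨rfl, rfl⟩ | rfl
    · omega
    · omega
    · omega
  · omega

theorem IsStaircase.isTriangulation (hn : 3 ≤ n) :
    IsTriangulation ((Ico 2 (n - 1)).image (chord n L)) := by
  refine ⟨?_, ?_, ?_⟩
  · rw [card_image_of_injOn, Nat.card_Ico]
    · omega
    · exact hL.chord_injOn.mono fun m hm => by
        simp only [coe_Ico, Set.mem_Ico] at hm ⊢; omega
  · intro e he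
    obtain ⟨m, hm, rfl⟩ := mem_image.1 he
    rw [mem_Ico] at hm
    have hw := hL.window (n := n) (m := m) (by omega)
    refine ⟨card_pair ?_, ?_⟩
    · rw [Ne, cast_inj_of_window (A := L (n - 1))] <;> omega
    · rw [chord, pair_mem_sides hn hw.1 (by omega) hw.2]
      omega
  · intro e he e' he'
    obtain ⟨m, hm, rfl⟩ := mem_image.1 he
    obtain ⟨m', hm', rfl⟩ := mem_image.1 he'
    rw [mem_Ico] at hm hm'
    exact hL.not_cross (by omega) (by omega) (by omega) (by omega)

end

/-! ### Plane vectors realizing the weights -/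

/-- The determinant of two of the vectors of a sequence. -/
def pairing {K : Type*} [Field K] (v : ℤ → K × K) (i j : ℤ) : K :=
  (v i).1 * (v j).2 - (v i).2 * (v j).1

theorem pairing_plucker {K : Type*} [Field K] (v : ℤ → K × K) (a b c d : ℤ) :
    pairing v a c * pairing v b d =
      pairing v a b * pairing v c d + pairing v a d * pairing v b c := by
  simp only [pairing]; ring

theorem pairing_congr {K : Type*} [Field K] {v v' : ℤ → K × K} {i j : ℤ} (hi : v i = v' i)
    (hj : v j = v' j) : pairing v i j = pairing v' i j := by
  simp only [pairing, hi, hj]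

/-- The vectors `v` realize the weights `X` on the first `M` steps of the staircase `L`. -/
structure Realizes {K : Type*} [Field K] (L : ℕ → ℤ) (X : ℕ → K) (M : ℕ) (v : ℤ → K × K) :
    Prop where
  chord : ∀ m, 1 ≤ m → m ≤ M → pairing v (L m) (L m + m) = X m
  side : ∀ i, L M ≤ i → i < L M + M → pairing v i (i + 1) = 1

/-- The end vectors of the `M`-th interval have determinant `X M ≠ 0`, hence form a basis. The new
vector is the one whose determinants with them are `1` and `X (M + 1)`. -/
theorem IsStaircase.exists_realizes {K : Type*} [Field K] {L : ℕ → ℤ} (hL : IsStaircase L)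
    {X : ℕ → K} (hX : ∀ m, X m ≠ 0) (hX1 : X 1 = 1) {M : ℕ} (hM : 1 ≤ M) :
    ∃ v, Realizes L X M v := by
  induction M, hM using Nat.le_induction with
  | base =>
    have h : pairing (fun i => if i = L 1 then ((1, 0) : K × K) else (0, 1)) (L 1) (L 1 + 1) =
        1 := by
      simp [pairing]
    refine ⟨fun i => if i = L 1 then (1, 0) else (0, 1), ?_, ?_⟩
    · intro m h1 h2
      obtain rfl : m = 1 := by omega
      rw [hX1]
      simpa using h
    · intro i h1 h2
      obtain rfl : i = L 1 := by push_cast at h2; omega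
      exact h
  | succ M hM ih =>
    obtain ⟨v, hv⟩ := ih
    have hc := hv.chord M hM le_rfl
    have hXM := hX M
    rcases hL M with h | h
    · let t : K × K := (X M)⁻¹ • (X (M + 1) • v (L M + M) - v (L M))
      let v' : ℤ → K × K := Function.update v (L M + M + 1) t
      have old : ∀ i, i ≠ L M + M + 1 → v' i = v i := fun i hi => Function.update_of_ne hi _ _
      have new : v' (L M + M + 1) = t := Function.update_self ..
      have new_side : pairing v' (L M + M) (L M + M + 1) = 1 := by
        simp only [pairing, old _ (show L M + M ≠ L M + M + 1 by omega), new, t] at hc ⊢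
        simp only [Prod.smul_fst, Prod.smul_snd, Prod.fst_sub, Prod.snd_sub, smul_eq_mul]
        field_simp
        linear_combination hc
      have new_chord : pairing v' (L M) (L M + M + 1) = X (M + 1) := by
        simp only [pairing, old _ (show L M ≠ L M + M + 1 by omega), new, t] at hc ⊢
        simp only [Prod.smul_fst, Prod.smul_snd, Prod.fst_sub, Prod.snd_sub, smul_eq_mul]
        field_simp
        linear_combination X (M + 1) * hc
      refine ⟨v', ?_, ?_⟩
      · intro m h1 h2
        rcases h2.eq_or_lt with rfl | h2
        · rw [h]; push_cast; rw [← add_assoc]; exact new_chord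
        · have := hL.nested (show m ≤ M by omega)
          rw [pairing_congr (old _ (by omega)) (old _ (by omega))]
          exact hv.chord m h1 (by omega)
      · intro i h1 h2
        push_cast at h2
        by_cases hi : i = L M + M
        · rw [hi]; exact new_side
        · rw [pairing_congr (old _ (by omega)) (old _ (by omega))]
          exact hv.side i (by omega) (by omega)
    · let t : K × K := (X M)⁻¹ • (X (M + 1) • v (L M) - v (L M + M))
      let v' : ℤ → K × K := Function.update v (L M - 1) t
      have old : ∀ i, i ≠ L M - 1 → v' i = v i := fun i hi => Function.update_of_ne hi _ _
      have new : v' (L M - 1) = t := Function.update_self ..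
      have new_side : pairing v' (L M - 1) (L M) = 1 := by
        simp only [pairing, old _ (show L M ≠ L M - 1 by omega), new, t] at hc ⊢
        simp only [Prod.smul_fst, Prod.smul_snd, Prod.fst_sub, Prod.snd_sub, smul_eq_mul]
        field_simp
        linear_combination hc
      have new_chord : pairing v' (L M - 1) (L M + M) = X (M + 1) := by
        simp only [pairing, old _ (show L M + M ≠ L M - 1 by omega), new, t] at hc ⊢
        simp only [Prod.smul_fst, Prod.smul_snd, Prod.fst_sub, Prod.snd_sub, smul_eq_mul]
        field_simp
        linear_combination X (M + 1) * hc
      refine ⟨v', ?_, ?_⟩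
      · intro m h1 h2
        rcases h2.eq_or_lt with rfl | h2
        · rw [h]; push_cast; rw [sub_add_add_cancel]; exact new_chord
        · have := hL.nested (show m ≤ M by omega)
          rw [pairing_congr (old _ (by omega)) (old _ (by omega))]
          exact hv.chord m h1 (by omega)
      · intro i h1 h2
        push_cast at h2
        by_cases hi : i = L M - 1
        · rw [hi, sub_add_cancel]; exact new_side
        · rw [pairing_congr (old _ (by omega)) (old _ (by omega))]
          exact hv.side i (by omega) (by omega)

theorem Realizes.mono {K : Type*} [Field K] {L : ℕ → ℤ} (hL : IsStaircase L) {X : ℕ → K}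
    {M M' : ℕ} (h : M' ≤ M) {v : ℤ → K × K} (hv : Realizes L X M v) : Realizes L X M' v where
  chord m h1 h2 := hv.chord m h1 (h2.trans h)
  side i h1 h2 := by
    have := hL.nested h
    exact hv.side i (by omega) (by omega)

/-- A property of the weights that is stable under the subtraction-free operations holds for all
values of the pairing. -/
theorem Realizes.induction {K : Type*} [Field K] {L : ℕ → ℤ} (hL : IsStaircase L) {X : ℕ → K}
    (hX : ∀ m, X m ≠ 0) (P : K → Prop) (hone : P 1) (hadd : ∀ x y, P x → P y → P (x + y))
    (hmul : ∀ m x, P x → P (x * X m)) (hdiv : ∀ m x, P x → P (x / X m)) {M : ℕ}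
    {v : ℤ → K × K} (hv : Realizes L X M v) {i j : ℤ} (hi : L M ≤ i) (hij : i < j)
    (hj : j ≤ L M + M) : P (pairing v i j) := by
  induction M generalizing i j with
  | zero => push_cast at hj; omega
  | succ M ih =>
    have hXP : ∀ m, P (X m) := fun m => by simpa using hmul m 1 hone
    have ih' := @ih (hv.mono hL M.le_succ)
    have hend : P (pairing v (L (M + 1)) (L (M + 1) + (M + 1 : ℕ))) := by
      rw [hv.chord (M + 1) (by omega) le_rfl]; exact hXP _
    rcases Nat.eq_zero_or_pos M with rfl | hM
    · rw [zero_add] at hi hj hend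
      push_cast at hj hend
      obtain rfl : i = L 1 := by omega
      obtain rfl : j = L 1 + 1 := by omega
      simpa using hend
    have hc := hv.chord M hM M.le_succ
    have hXM := hX M
    rcases hL M with h | h
    · rw [h] at hi hj hend
      push_cast at hj hend
      by_cases hju : j ≤ L M + M
      · exact ih' hi hij hju
      obtain rfl : j = L M + M + 1 := by omega
      have hs : pairing v (L M + M) (L M + M + 1) = 1 :=
        hv.side _ (by omega) (by push_cast; omega)
      by_cases hil : i = L M
      · rw [hil, add_assoc]; exact hend
      by_cases hir : i = L M + M
      · rw [hir, hs]; exact hone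
      -- In this relation the chord of the `M`-th interval, the next chord and the new side have
      -- known values, so the determinant of `i` and the new point is obtained by dividing by `X M`
      -- alone.
      have hp := pairing_plucker v (L M) i (L M + M) (L M + M + 1)
      have hcc := hv.chord (M + 1) (by omega) le_rfl
      rw [h] at hcc
      push_cast at hcc
      rw [← add_assoc] at hcc
      rw [hc, hs, hcc] at hp
      have : pairing v i (L M + M + 1) =
          (pairing v (L M) i + pairing v i (L M + M) * X (M + 1)) / X M := by
        rw [eq_div_iff hXM]; linear_combination hp
      rw [this]
      exact hdiv _ _ (hadd _ _ (ih' le_rfl (by omega) (by omega))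
        (hmul _ _ (ih' hi (by omega) le_rfl)))
    · rw [h] at hi hj hend
      push_cast at hj hend
      by_cases hju : L M ≤ i
      · exact ih' hju hij (by omega)
      obtain rfl : i = L M - 1 := by omega
      have hs : pairing v (L M - 1) (L M) = 1 := by
        have := hv.side (L M - 1) (by omega) (by push_cast; omega)
        rwa [sub_add_cancel] at this
      by_cases hil : j = L M + M
      · rw [hil]; rw [sub_add_add_cancel] at hend; exact hend
      by_cases hir : j = L M
      · rw [hir, hs]; exact hone
      have hp := pairing_plucker v (L M - 1) (L M) j (L M + M)
      have hcc := hv.chord (M + 1) (by omega) le_rfl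
      rw [h] at hcc
      push_cast at hcc
      rw [sub_add_add_cancel] at hcc
      rw [hc, hs, hcc] at hp
      have : pairing v (L M - 1) j =
          (pairing v j (L M + M) + pairing v (L M) j * X (M + 1)) / X M := by
        rw [eq_div_iff hXM]; linear_combination hp
      rw [this]
      exact hdiv _ _ (hadd _ _ (ih' (by omega) (by omega) le_rfl)
        (hmul _ _ (ih' le_rfl (by omega) (by omega))))

/-! ### Antiperiodic continuation -/

/-- The representative of an integer modulo `n` in the window starting with `A`. -/
def windowLift (n : ℕ) (A x : ℤ) : ℤ := A + (x - A) % n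

theorem windowLift_eq {n : ℕ} {A x : ℤ} (h : A ≤ x) (h' : x < A + n) : windowLift n A x = x := by
  rw [windowLift, Int.emod_eq_of_lt] <;> omega

theorem le_windowLift {n : ℕ} (hn : 0 < n) (A x : ℤ) : A ≤ windowLift n A x := by
  have := Int.emod_nonneg (x - A) (show (n : ℤ) ≠ 0 by omega)
  rw [windowLift]; omega

theorem windowLift_lt {n : ℕ} (hn : 0 < n) (A x : ℤ) : windowLift n A x < A + n := by
  have := Int.emod_lt_of_pos (x - A) (show (0 : ℤ) < n by omega)
  rw [windowLift]; omega

theorem windowLift_add_ediv (n : ℕ) (A x : ℤ) : windowLift n A x + n * ((x - A) / n) = x := by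
  have := Int.mul_ediv_add_emod (x - A) n
  rw [windowLift]; omega

theorem cast_windowLift (n : ℕ) (A x : ℤ) : ((windowLift n A x : ℤ) : ZMod n) = x := by
  simp [windowLift]

theorem windowLift_periodic (n : ℕ) (A x q : ℤ) :
    windowLift n A (x + n * q) = windowLift n A x := by
  rw [windowLift, windowLift, show x + n * q - A = x - A + n * q by ring,
    Int.add_mul_emod_self_left]

/-- The continuation of a sequence of `n` vectors to one that changes sign after `n` steps. -/
def antiperiodize {K : Type*} [Field K] (n : ℕ) (A : ℤ) (v : ℤ → K × K) (x : ℤ) : K × K :=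
  ((-1 : K) ^ ((x - A) / n)) • v (windowLift n A x)

theorem pairing_antiperiodize {K : Type*} [Field K] (n : ℕ) (A : ℤ) (v : ℤ → K × K) (x y : ℤ) :
    pairing (antiperiodize n A v) x y =
      (-1 : K) ^ ((x - A) / n) * (-1 : K) ^ ((y - A) / n) *
        pairing v (windowLift n A x) (windowLift n A y) := by
  simp only [pairing, antiperiodize, Prod.smul_fst, Prod.smul_snd, smul_eq_mul]
  ring

theorem antiperiodize_add {K : Type*} [Field K] {n : ℕ} (hn : 0 < n) (A : ℤ) (v : ℤ → K × K)
    (x : ℤ) : antiperiodize n A v (x + n) = -antiperiodize n A v x := by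
  have hn' : (n : ℤ) ≠ 0 := by omega
  have e : (x + n - A) = (x - A) + n * 1 := by ring
  simp only [antiperiodize, windowLift, e, Int.add_mul_emod_self_left]
  rw [Int.add_mul_ediv_left _ _ hn', zpow_add₀ (by simp), zpow_one]
  simp

theorem neg_one_zpow_mul_self {K : Type*} [Field K] (s : ℤ) : (-1 : K) ^ s * (-1 : K) ^ s = 1 := by
  rw [← mul_zpow]; simp

/-- The entries of the table of an antiperiodic sequence, in terms of a window. -/
theorem pairing_antiperiodize_cases {K : Type*} [Field K] {n : ℕ} (hn : 0 < n) (A : ℤ)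
    (v : ℤ → K × K) {x y : ℤ} (h1 : 1 ≤ y - x) (h2 : y - x < n) :
    (windowLift n A x < windowLift n A y ∧ pairing (antiperiodize n A v) x y =
      pairing v (windowLift n A x) (windowLift n A y)) ∨
    (windowLift n A y < windowLift n A x ∧ pairing (antiperiodize n A v) x y =
      pairing v (windowLift n A y) (windowLift n A x)) := by
  rw [pairing_antiperiodize]
  have hx := windowLift_add_ediv n A x
  have hy := windowLift_add_ediv n A y
  have hx1 := le_windowLift hn A x
  have hy1 := le_windowLift hn A y
  have hx2 := windowLift_lt hn A x
  have hy2 := windowLift_lt hn A y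
  generalize (x - A) / n = s at *
  generalize (y - A) / n = t at *
  generalize windowLift n A x = x' at *
  generalize windowLift n A y = y' at *
  have hn0 : (0 : ℤ) < n := by omega
  -- As `y - x` lies between `1` and `n - 1`, the two points are in the same period or in adjacent
  -- ones. In the second case the sign from antiperiodicity is absorbed by exchanging the arguments
  -- of the determinant.
  have ht1 : s ≤ t := by
    by_contra h
    have : (n : ℤ) * (t + 1) ≤ n * s := mul_le_mul_of_nonneg_left (by omega) hn0.le
    rw [mul_add] at this
    omega
  have ht2 : t ≤ s + 1 := by
    by_contra h
    have : (n : ℤ) * (s + 2) ≤ n * t := mul_le_mul_of_nonneg_left (by omega) hn0.le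
    rw [mul_add] at this
    omega
  rcases ht1.eq_or_lt with rfl | h
  · left
    rw [neg_one_zpow_mul_self, one_mul]
    exact ⟨by omega, rfl⟩
  · right
    obtain rfl : t = s + 1 := by omega
    rw [mul_add] at hy
    refine ⟨by omega, ?_⟩
    rw [zpow_add₀ (by simp), zpow_one, ← mul_assoc, neg_one_zpow_mul_self]
    simp only [pairing]
    ring

/-- The only side not covered by `Realizes.side` crosses from one period to the next. Up to the
cancelling sign it is the longest chord of the staircase, which has weight `X (n - 1) = 1`. -/
theorem pairing_antiperiodize_side {K : Type*} [Field K] {n : ℕ} {L : ℕ → ℤ} {X : ℕ → K}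
    (hn : 2 ≤ n) (hX : X (n - 1) = 1) {v : ℤ → K × K} (hv : Realizes L X (n - 1) v)
    (i : ℤ) : pairing (antiperiodize n (L (n - 1)) v) i (i + 1) = 1 := by
  have hn0 : 0 < n := by omega
  have hx := windowLift_add_ediv n (L (n - 1)) i
  have hx1 := le_windowLift hn0 (L (n - 1)) i
  have hx2 := windowLift_lt hn0 (L (n - 1)) i
  have hlift : windowLift n (L (n - 1)) (i + 1) =
      windowLift n (L (n - 1)) (windowLift n (L (n - 1)) i + 1) := by
    rw [← windowLift_periodic n _ (windowLift n (L (n - 1)) i + 1) ((i - L (n - 1)) / n),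
      add_right_comm, hx]
  rcases pairing_antiperiodize_cases hn0 (L (n - 1)) v (x := i) (y := i + 1) (by omega)
    (by omega) with ⟨h, e⟩ | ⟨h, e⟩
  · rw [e, hlift]
    rw [hlift] at h
    by_cases hlast : windowLift n (L (n - 1)) i + 1 < L (n - 1) + n
    · rw [windowLift_eq (by omega) hlast]
      exact hv.side _ hx1 (by omega)
    · exfalso
      have : windowLift n (L (n - 1)) (windowLift n (L (n - 1)) i + 1) = L (n - 1) := by
        rw [windowLift, show windowLift n (L (n - 1)) i + 1 - L (n - 1) = n by omega, Int.emod_self,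
          add_zero]
      omega
  · rw [e]
    rw [hlift] at h ⊢
    by_cases hlast : windowLift n (L (n - 1)) i + 1 < L (n - 1) + n
    · rw [windowLift_eq (by omega) hlast] at h
      omega
    · have : windowLift n (L (n - 1)) (windowLift n (L (n - 1)) i + 1) = L (n - 1) := by
        rw [windowLift, show windowLift n (L (n - 1)) i + 1 - L (n - 1) = n by omega, Int.emod_self,
          add_zero]
      rw [this, show windowLift n (L (n - 1)) i = L (n - 1) + (n - 1 : ℕ) by omega,
        hv.chord (n - 1) (by omega) le_rfl, hX]

/-! ### Matching sums as determinants -/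

/-- The symmetric function of two vertices of the polygon given by the pairing in a window. -/
def windowPairing {K : Type*} [Field K] {n : ℕ} (A : ℤ) (v : ℤ → K × K) (x y : ZMod n) : K :=
  pairing v (min (windowLift n A x.val) (windowLift n A y.val))
    (max (windowLift n A x.val) (windowLift n A y.val))

theorem windowPairing_comm {K : Type*} [Field K] {n : ℕ} (A : ℤ) (v : ℤ → K × K) (x y : ZMod n) :
    windowPairing A v x y = windowPairing A v y x := by
  rw [windowPairing, windowPairing, min_comm, max_comm]

theorem windowPairing_cast {K : Type*} [Field K] {n : ℕ} [NeZero n] {A : ℤ} (v : ℤ → K × K)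
    {i j : ℤ} (hi : A ≤ i) (hij : i ≤ j) (hj : j < A + n) :
    windowPairing A v (i : ZMod n) (j : ZMod n) = pairing v i j := by
  have key : ∀ x : ℤ, A ≤ x → x < A + n → windowLift n A ((x : ZMod n).val : ℤ) = x := by
    intro x h h'
    rw [ZMod.val_intCast, windowLift, Int.emod_sub_emod]
    exact windowLift_eq h h'
  rw [windowPairing, key i hi (by omega), key j (by omega) hj, min_eq_left hij, max_eq_right hij]

/-- Induction over the subpolygons on the points of the `m`-th interval. The start is a single side
with no triangles, where the empty matching gives `1`; each step is one application of
`incidenceSum_glue`. -/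
theorem IsStaircase.incidenceSum_eq {K : Type*} [Field K] {n : ℕ} [NeZero n] {L : ℕ → ℤ}
    (hL : IsStaircase L) {X : ℕ → K} {v : ℤ → K × K} (hv : Realizes L X (n - 1) v)
    {c : Finset (ZMod n) → K} (hchord : ∀ m, 1 ≤ m → m < n → c (chord n L m) = X m)
    (hside : ∀ i : ℤ, L (n - 1) ≤ i → i + 1 < L (n - 1) + n →
      c {(i : ZMod n), ((i + 1 : ℤ) : ZMod n)} = 1)
    {m : ℕ} (h1 : 1 ≤ m) (hm : m < n) :
    ∀ x ∈ (Icc (L m) (L m + m)).image (Int.cast : ℤ → ZMod n),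
    ∀ y ∈ (Icc (L m) (L m + m)).image (Int.cast : ℤ → ZMod n), x ≠ y →
      incidenceSum (fun e => c (e.2.erase e.1))
        ((((Icc (L m) (L m + m)).image (Int.cast : ℤ → ZMod n)).erase x).erase y)
        ((Ico 1 m).image (stairTriangle n L)) =
      windowPairing (L (n - 1)) v x y * ∏ k ∈ Ico 1 m, X k := by
  induction m, h1 using Nat.le_induction with
  | base =>
    intro x hx y hy hxy
    have hw := hL.window (n := n) (m := 1) (by omega)
    push_cast at hw
    have hI : (Icc (L 1) (L 1 + (1 : ℕ))).image (Int.cast : ℤ → ZMod n) =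
        {(L 1 : ZMod n), ((L 1 + 1 : ℤ) : ZMod n)} := by
      rw [show Icc (L 1) (L 1 + (1 : ℕ)) = {L 1, L 1 + 1} by
        ext; simp only [mem_Icc, mem_insert, mem_singleton]; push_cast; omega]
      simp
    rw [hI] at hx hy ⊢
    have hQ : windowPairing (L (n - 1)) v (L 1 : ZMod n) ((L 1 + 1 : ℤ) : ZMod n) = 1 := by
      rw [windowPairing_cast v hw.1 (by omega) hw.2]
      have := hv.side (L 1) (by omega) (by omega)
      exact this
    have hQ' : windowPairing (L (n - 1)) v x y = 1 := by
      simp only [mem_insert, mem_singleton] at hx hy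
      rcases hx with rfl | rfl <;> rcases hy with rfl | rfl
      · exact absurd rfl hxy
      · exact hQ
      · rw [windowPairing_comm]; exact hQ
      · exact absurd rfl hxy
    have hE : (({(L 1 : ZMod n), ((L 1 + 1 : ℤ) : ZMod n)} : Finset (ZMod n)).erase x).erase y =
        ∅ := by grind
    rw [hE, hQ', Ico_self, image_empty, incidenceSum_empty]
    simp
  | succ m h1 ih =>
    have hw := hL.window (n := n) (m := m) (by omega)
    have hw' := hL.window (n := n) (m := m + 1) (by omega)
    have hu := hL.newVertex_window hm
    have hIco : Ico 1 (m + 1) = insert m (Ico 1 m) := by ext; simp only [mem_Ico, mem_insert]; omega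
    have hV : (Icc (L (m + 1)) (L (m + 1) + (m + 1 : ℕ))).image (Int.cast : ℤ → ZMod n) =
        insert (newVertex L m : ZMod n) ((Icc (L m) (L m + m)).image (Int.cast : ℤ → ZMod n)) := by
      rw [← image_insert]
      congr 1
      ext i
      simp only [mem_Icc, mem_insert]
      push_cast
      rcases hL.chord_succ (n := n) m with ⟨h, h', -⟩ | ⟨h, h', -⟩ <;> rw [h, h'] <;> omega
    have hnew : newVertex L m < L m ∨ L m + m < newVertex L m := by
      rcases hL.chord_succ (n := n) m with ⟨h, h', -⟩ | ⟨h, h', -⟩ <;> rw [h] <;> omega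
    have huV : ∀ k ≤ m, ∀ i, L k ≤ i → i ≤ L k + k →
        (newVertex L m : ZMod n) ≠ (i : ZMod n) := by
      intro k hk i hi hi'
      have := hL.nested hk
      rw [Ne, cast_inj_of_window (A := L (n - 1)) hu.1 hu.2 (by omega) (by omega)]
      omega
    have hnot : (newVertex L m : ZMod n) ∉ (Icc (L m) (L m + m)).image (Int.cast : ℤ → ZMod n) := by
      intro h
      obtain ⟨i, hi, hi'⟩ := mem_image.1 h
      rw [mem_Icc] at hi
      exact huV m le_rfl i hi.1 hi.2 hi'.symm
    have hU : ∀ t ∈ (Ico 1 m).image (stairTriangle n L), (newVertex L m : ZMod n) ∉ t := by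
      intro t ht hmem
      obtain ⟨k, hk, rfl⟩ := mem_image.1 ht
      rw [mem_Ico] at hk
      simp only [stairTriangle, chord, mem_union, mem_insert, mem_singleton] at hmem
      rcases hmem with (h | h) | (h | h)
      · exact huV k (by omega) _ le_rfl (by omega) h
      · exact huV k (by omega) _ (by omega) le_rfl h
      · exact huV (k + 1) (by omega) _ le_rfl (by omega) h
      · exact huV (k + 1) (by omega) _ (by omega) le_rfl h
    have hab : (L m : ZMod n) ≠ ((L m + m : ℤ) : ZMod n) := by
      rw [Ne, cast_inj_of_window (A := L (n - 1))] <;> omega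
    have hQab : windowPairing (L (n - 1)) v (L m : ZMod n) ((L m + m : ℤ) : ZMod n) = X m := by
      rw [windowPairing_cast v hw.1 (by omega) hw.2, hv.chord m h1 (by omega)]
    have hchord' := hchord (m + 1) (by omega) hm
    have hX' := hv.chord (m + 1) (by omega) (by omega)
    -- The new factor `X m` is rewritten as the value of the gluing chord, which is the factor
    -- produced by gluing.
    rw [hV, hIco, image_insert, hL.stairTriangle_eq, prod_insert (by simp), mul_comm (X m), ← hQab]
    refine incidenceSum_glue c (windowPairing (L (n - 1)) v) (∏ k ∈ Ico 1 m, X k)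
      (windowPairing_comm _ _) (mem_image_of_mem _ (mem_Icc.2 ⟨le_rfl, by omega⟩))
      (mem_image_of_mem _ (mem_Icc.2 ⟨by omega, le_rfl⟩)) hab hnot hU ?_ ?_ ?_ ?_ (ih (by omega))
    · rw [hQab]
      exact hchord m h1 (by omega)
    · rcases hL.chord_succ (n := n) m with ⟨h, h', hc⟩ | ⟨h, h', hc⟩
      · rw [← hc, hchord', windowPairing_cast v hw.1 (by omega) hu.2, h, ← hX', h']
        push_cast
        rw [add_assoc]
      · rw [pair_comm, windowPairing_comm, windowPairing_cast v hu.1 (by omega) (by omega), h]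
        have e1 := hside (L m - 1) (by omega) (by omega)
        have e2 := hv.side (L m - 1) (by omega) (by omega)
        rw [sub_add_cancel] at e1 e2
        rw [e1, e2]
    · rcases hL.chord_succ (n := n) m with ⟨h, h', hc⟩ | ⟨h, h', hc⟩
      · rw [windowPairing_cast v (by omega) (by omega) hu.2, h, hv.side _ (by omega) (by omega)]
        exact hside _ (by omega) (by omega)
      · rw [pair_comm, ← hc, hchord', windowPairing_comm,
          windowPairing_cast v hu.1 (by omega) (by omega), h, ← hX', h']
        push_cast
        rw [sub_add_add_cancel]
    · intro x hx
      obtain ⟨i, hi, rfl⟩ := mem_image.1 hx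
      rw [mem_Icc] at hi
      rw [windowPairing_cast v hw.1 (by omega) hw.2,
        windowPairing_cast v (by omega) hi.2 hw.2,
        windowPairing_comm _ _ (i : ZMod n) (L m : ZMod n),
        windowPairing_cast v hw.1 hi.1 (by omega)]
      -- Ptolemy's relation is the Plücker relation for the four points in increasing order, the new
      -- vertex coming first or last.
      rcases hnew with h | h
      · rw [windowPairing_comm _ _ (i : ZMod n) (newVertex L m : ZMod n),
          windowPairing_comm _ _ (L m : ZMod n) (newVertex L m : ZMod n),
          windowPairing_comm _ _ ((L m + m : ℤ) : ZMod n) (newVertex L m : ZMod n),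
          windowPairing_cast v hu.1 (by omega) (by omega),
          windowPairing_cast v hu.1 (by omega) (by omega),
          windowPairing_cast v hu.1 (by omega) (by omega)]
        exact pairing_plucker v _ _ _ _
      · rw [windowPairing_cast v (by omega) (by omega) hu.2,
          windowPairing_cast v (by omega) (by omega) hu.2,
          windowPairing_cast v (by omega) (by omega) hu.2]
        linear_combination pairing_plucker v (L m) i (L m + m) (newVertex L m)

/-! ### The staircase of a zig-zag -/

/-- The left end points of a zig-zag, continued to all rows. -/
def ZigZag.leftEnd {n : ℕ} (z : ZigZag n) (m : ℕ) : ℤ :=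
  -- Clamping the index repeats the left end of row `2` above it and that of row `n - 2` below it.
  -- For `n = 3` the zig-zag is empty and any constant will do.
  if h : 3 < n then (z.entry ⟨min (m - 2) (n - 4), by omega⟩).left else 0

theorem ZigZag.isStaircase {n : ℕ} (z : ZigZag n) : IsStaircase z.leftEnd := by
  intro m
  by_cases h : 3 < n
  · simp only [ZigZag.leftEnd, h, dite_true]
    by_cases hm : min (m + 1 - 2) (n - 4) = min (m - 2) (n - 4)
    · left
      congr 3
    · rcases z.step ⟨min (m - 2) (n - 4), by omega⟩ ⟨min (m + 1 - 2) (n - 4), by omega⟩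
        (by simp only; omega) with h | h
      · exact Or.inr h.1
      · exact Or.inl h.1
  · left
    simp [ZigZag.leftEnd, h]

theorem ZigZag.leftEnd_add_two {n : ℕ} (z : ZigZag n) (m : Fin (n - 3)) :
    z.leftEnd (m + 2) = (z.entry m).left := by
  have hm := m.isLt
  have h : 3 < n := by omega
  simp only [ZigZag.leftEnd, h, dite_true]
  congr 2
  ext
  simp only
  omega

theorem ZigZag.right_eq {n : ℕ} (z : ZigZag n) (m : Fin (n - 3)) :
    (z.entry m).right = z.leftEnd (m + 2) + (m + 2 : ℕ) := by
  have := z.row_entry m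
  rw [Entry.row] at this
  rw [z.leftEnd_add_two]
  push_cast
  omega

/-! ### Uniqueness -/

/-- The zig-zag, the top row and the bottom row cut the table into a left and a right part. In each,
an entry is the outer corner of a diamond whose other three corners are nearer to the zig-zag.
Solving for it divides by the opposite corner, so it suffices that one of the two tables has no
zeros. -/
theorem IsFriezeTable.eq_of_ne_zero {k : Type*} [Field k] {n : ℕ} {z : ZigZag n}
    {f g : Entry n → RationalFn k n} (hf : IsFriezeTable z f) (hg : IsFriezeTable z g)
    (hne : ∀ p, g p ≠ 0) : f = g := by
  have hL := z.isStaircase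
  have base : ∀ (p : Entry n) (m : ℕ), (m : ℤ) = p.row →
      (m = 1 ∨ m = n - 1 ∨ p.left = z.leftEnd m) → f p = g p := by
    intro p m hm h
    have h1 := p.one_le_row
    have h2 := p.row_le
    simp only [Entry.row] at hm
    by_cases hm1 : m = 1
    · rw [hf.top p (by simp only [Entry.row]; omega), hg.top p (by simp only [Entry.row]; omega)]
    by_cases hmn : m = n - 1
    · rw [hf.bottom p (by simp only [Entry.row]; omega),
        hg.bottom p (by simp only [Entry.row]; omega)]
    obtain ⟨j, rfl⟩ : ∃ j : Fin (n - 3), m = j + 2 := ⟨⟨m - 2, by omega⟩, by simp only; omega⟩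
    have hl := z.leftEnd_add_two j
    have hr := z.right_eq j
    have : p = z.entry j := by ext <;> omega
    rw [this, hf.zigzag, hg.zigzag]
  -- The induction runs on the horizontal coordinate: on the right of the zig-zag the sum of the two
  -- indices is bounded below, and it is smaller at the other three corners.
  have right : ∀ (N : ℕ) (p : Entry n) (m : ℕ), (m : ℤ) = p.row → z.leftEnd m ≤ p.left →
      p.left + p.right ≤ 2 * z.leftEnd (n - 1) + N → f p = g p := by
    intro N
    induction N with
    | zero =>
      intro p m hm hl hN
      have h1 := p.one_le_row
      have h2 := p.row_le
      simp only [Entry.row] at hm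
      have := hL.nested (show m ≤ n - 1 by omega)
      push_cast at hN
      omega
    | succ N ih =>
      intro p m hm hl hN
      by_cases hb : m = 1 ∨ m = n - 1 ∨ p.left = z.leftEnd m
      · exact base p m hm hb
      have h1 := p.one_le_row
      have h2 := p.row_le
      simp only [Entry.row] at hm
      obtain ⟨q, rfl⟩ : ∃ q, m = q + 1 := ⟨m - 1, by omega⟩
      have s1 := hL q
      have s2 := hL (q + 1)
      push_cast at hN hm
      let A : Entry n := ⟨p.left, p.right - 1, by omega, by omega⟩
      let B : Entry n := ⟨p.left - 1, p.right - 1, by omega, by omega⟩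
      let D : Entry n := ⟨p.left - 1, p.right, by omega, by omega⟩
      have hd : IsDiamond A B p D :=
        ⟨⟨rfl, rfl⟩, ⟨rfl, (sub_add_cancel _ _).symm⟩, ⟨rfl, (sub_add_cancel _ _).symm⟩,
          ⟨rfl, rfl⟩⟩
      have eA : f A = g A := ih A q (by simp only [A, Entry.row]; omega)
        (by simp only [A]; omega) (by simp only [A]; omega)
      have eB : f B = g B := ih B (q + 1) (by simp only [B, Entry.row]; omega)
        (by simp only [B]; omega) (by simp only [B]; omega)
      have eD : f D = g D := ih D (q + 1 + 1) (by simp only [D, Entry.row]; omega)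
        (by simp only [D]; omega) (by simp only [D]; omega)
      have e1 := hf.frieze A B p D hd
      have e2 := hg.frieze A B p D hd
      rw [eA, eB, eD] at e1
      exact mul_left_cancel₀ (hne B) (by linear_combination e2 - e1)
  -- The mirror image: the sum of the indices is bounded above and increases towards the zig-zag.
  have left : ∀ (N : ℕ) (p : Entry n) (m : ℕ), (m : ℤ) = p.row → p.left ≤ z.leftEnd m →
      2 * z.leftEnd 0 + n ≤ p.left + p.right + N → f p = g p := by
    intro N
    induction N with
    | zero =>
      intro p m hm hl hN
      have h1 := p.one_le_row
      have h2 := p.row_le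
      simp only [Entry.row] at hm
      have := hL.nested (show 0 ≤ m by omega)
      push_cast at hN
      omega
    | succ N ih =>
      intro p m hm hl hN
      by_cases hb : m = 1 ∨ m = n - 1 ∨ p.left = z.leftEnd m
      · exact base p m hm hb
      have h1 := p.one_le_row
      have h2 := p.row_le
      simp only [Entry.row] at hm
      obtain ⟨q, rfl⟩ : ∃ q, m = q + 1 := ⟨m - 1, by omega⟩
      have s1 := hL q
      have s2 := hL (q + 1)
      push_cast at hN hm
      let A : Entry n := ⟨p.left + 1, p.right, by omega, by omega⟩
      let C : Entry n := ⟨p.left + 1, p.right + 1, by omega, by omega⟩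
      let D : Entry n := ⟨p.left, p.right + 1, by omega, by omega⟩
      have hd : IsDiamond A p C D :=
        ⟨⟨(add_sub_cancel_right _ _).symm, rfl⟩, ⟨rfl, rfl⟩, ⟨rfl, rfl⟩,
          ⟨(add_sub_cancel_right _ _).symm, rfl⟩⟩
      have eA : f A = g A := ih A q (by simp only [A, Entry.row]; omega)
        (by simp only [A]; omega) (by simp only [A]; omega)
      have eC : f C = g C := ih C (q + 1) (by simp only [C, Entry.row]; omega)
        (by simp only [C]; omega) (by simp only [C]; omega)
      have eD : f D = g D := ih D (q + 1 + 1) (by simp only [D, Entry.row]; omega)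
        (by simp only [D]; omega) (by simp only [D]; omega)
      have e1 := hf.frieze A p C D hd
      have e2 := hg.frieze A p C D hd
      rw [eA, eC, eD] at e1
      exact mul_right_cancel₀ (hne C) (by linear_combination e2 - e1)
  funext p
  have h1 := p.one_le_row
  obtain ⟨m, hm⟩ : ∃ m : ℕ, (m : ℤ) = p.row :=
    ⟨p.row.toNat, by simp only [Entry.row]; omega⟩
  rcases le_total (z.leftEnd m) p.left with h | h
  · exact right (p.left + p.right - 2 * z.leftEnd (n - 1)).toNat p m hm h (by omega)
  · exact left (2 * z.leftEnd 0 + n - (p.left + p.right)).toNat p m hm h (by omega)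

/-! ### Positivity -/

section

variable {k : Type*} [Field k] {n : ℕ}

theorem formalVar_ne_zero (m : Fin (n - 3)) : formalVar k n m ≠ 0 := by
  rw [formalVar, Ne, map_eq_zero_iff _ (IsFractionRing.injective _ _)]
  exact MvPolynomial.X_ne_zero m

theorem isPositiveLaurent_one : IsPositiveLaurent (1 : RationalFn k n) :=
  ⟨Finsupp.single 0 1, by simp, by simp⟩

theorem IsPositiveLaurent.add {g h : RationalFn k n} (hg : IsPositiveLaurent g)
    (hh : IsPositiveLaurent h) : IsPositiveLaurent (g + h) := by
  obtain ⟨L, hL, rfl⟩ := hg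
  obtain ⟨L', -, rfl⟩ := hh
  refine ⟨L + L', fun h0 => hL ?_, ?_⟩
  · ext e
    have := DFunLike.congr_fun h0 e
    simp only [Finsupp.add_apply, Finsupp.zero_apply] at this ⊢
    omega
  · rw [Finsupp.sum_add_index'] <;> simp [add_mul]

/-- A monomial only translates the exponent vectors, so both multiplication and division by a
variable are covered. -/
theorem IsPositiveLaurent.mul_monomial {g : RationalFn k n} (hg : IsPositiveLaurent g)
    (d : Fin (n - 3) → ℤ) : IsPositiveLaurent (g * ∏ m, formalVar k n m ^ d m) := by
  obtain ⟨L, hL, rfl⟩ := hg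
  refine ⟨L.mapDomain (· + d), fun h0 => hL ?_, ?_⟩
  · exact Finsupp.mapDomain_injective (add_left_injective d) (h0.trans Finsupp.mapDomain_zero.symm)
  · rw [Finsupp.sum_mapDomain_index (by simp) (by simp [add_mul]), Finsupp.sum_mul]
    refine Finsupp.sum_congr fun e _ => ?_
    rw [mul_assoc, ← prod_mul_distrib]
    congr 1
    exact prod_congr rfl fun m _ => (zpow_add₀ (formalVar_ne_zero m) _ _).symm

theorem IsPositiveLaurent.mul_formalVar {g : RationalFn k n} (hg : IsPositiveLaurent g)
    (m : Fin (n - 3)) : IsPositiveLaurent (g * formalVar k n m) := by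
  have := hg.mul_monomial (Pi.single m 1)
  rwa [prod_eq_single m (fun b _ hb => by simp [hb]) (by simp), Pi.single_eq_same, zpow_one] at this

theorem IsPositiveLaurent.div_formalVar {g : RationalFn k n} (hg : IsPositiveLaurent g)
    (m : Fin (n - 3)) : IsPositiveLaurent (g / formalVar k n m) := by
  have := hg.mul_monomial (Pi.single m (-1))
  rwa [prod_eq_single m (fun b _ hb => by simp [hb]) (by simp), Pi.single_eq_same, zpow_neg_one,
    ← div_eq_mul_inv] at this

/-- The rational functions that take a positive rational value when all variables are `1`. -/
def HasPositiveValue (g : RationalFn k n) : Prop :=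
  ∃ (P Q : MvPolynomial (Fin (n - 3)) k) (a b : ℕ), 0 < a ∧ 0 < b ∧
    MvPolynomial.eval 1 P = (a : k) ∧ MvPolynomial.eval 1 Q = (b : k) ∧
    g * algebraMap _ (RationalFn k n) Q = algebraMap _ (RationalFn k n) P

/-- A zero function would force the numerator, hence its value at `1`, to vanish, but in
characteristic zero a positive integer is nonzero in `k`. Keeping an explicit numerator and
denominator avoids evaluating rational functions. -/
theorem HasPositiveValue.ne_zero [CharZero k] {g : RationalFn k n} (hg : HasPositiveValue g) :
    g ≠ 0 := by
  rintro rfl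
  obtain ⟨P, Q, a, b, ha, -, hP, -, h⟩ := hg
  rw [zero_mul, eq_comm, map_eq_zero_iff _ (IsFractionRing.injective _ _)] at h
  rw [h, map_zero, eq_comm, Nat.cast_eq_zero] at hP
  omega

theorem hasPositiveValue_one : HasPositiveValue (1 : RationalFn k n) :=
  ⟨1, 1, 1, 1, one_pos, one_pos, by simp, by simp, by simp⟩

theorem HasPositiveValue.add {g h : RationalFn k n} (hg : HasPositiveValue g)
    (hh : HasPositiveValue h) : HasPositiveValue (g + h) := by
  obtain ⟨P, Q, a, b, ha, hb, hP, hQ, e⟩ := hg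
  obtain ⟨P', Q', a', b', ha', hb', hP', hQ', e'⟩ := hh
  refine ⟨P * Q' + P' * Q, Q * Q', a * b' + a' * b, b * b', by positivity, by positivity,
    by simp [hP, hQ, hP', hQ'], by simp [hQ, hQ'], ?_⟩
  simp only [map_add, map_mul, ← e, ← e']
  ring

theorem HasPositiveValue.mul_formalVar {g : RationalFn k n} (hg : HasPositiveValue g)
    (m : Fin (n - 3)) : HasPositiveValue (g * formalVar k n m) := by
  obtain ⟨P, Q, a, b, ha, hb, hP, hQ, e⟩ := hg
  refine ⟨P * MvPolynomial.X m, Q, a, b, ha, hb, by simp [hP], hQ, ?_⟩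
  rw [map_mul, ← e, formalVar]
  ring

theorem HasPositiveValue.div_formalVar {g : RationalFn k n} (hg : HasPositiveValue g)
    (m : Fin (n - 3)) : HasPositiveValue (g / formalVar k n m) := by
  obtain ⟨P, Q, a, b, ha, hb, hP, hQ, e⟩ := hg
  refine ⟨P, Q * MvPolynomial.X m, a, b, ha, hb, hP, by simp [hQ], ?_⟩
  have := formalVar_ne_zero (k := k) m
  rw [← e, map_mul, ← formalVar]
  field_simp

end

/-! ### The weights of the chords -/

section

/-- The weight of the chord in row `m`: a formal variable, or `1` in the first and last row. -/
noncomputable def rowWeight (k : Type*) [Field k] (n m : ℕ) : RationalFn k n :=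
  if h : 2 ≤ m ∧ m < n - 1 then formalVar k n ⟨m - 2, by omega⟩ else 1

theorem rowWeight_add_two {k : Type*} [Field k] {n : ℕ} (m : Fin (n - 3)) :
    rowWeight k n (m + 2) = formalVar k n m := by
  have := m.isLt
  rw [rowWeight, dif_pos ⟨by omega, by omega⟩]
  rfl

theorem prod_rowWeight {k : Type*} [Field k] {n : ℕ} (hn : 3 ≤ n) :
    ∏ m ∈ Ico 1 (n - 1), rowWeight k n m = ∏ m, formalVar k n m := by
  have h1 : rowWeight k n 1 = 1 := by simp [rowWeight]
  have h2 : ∏ m : Fin (n - 3), formalVar k n m = ∏ m : Fin (n - 3), rowWeight k n (m + 2) :=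
    prod_congr rfl fun m _ => (rowWeight_add_two m).symm
  rw [h2, Fin.prod_univ_eq_prod_range (fun i => rowWeight k n (i + 2)) (n - 3),
    prod_eq_prod_Ico_succ_bot (by omega), h1, one_mul, prod_Ico_eq_prod_range]
  exact prod_congr (by congr 1) fun m _ => by rw [add_comm]

variable {n : ℕ} (z : ZigZag n)

theorem ZigZag.diagonal_eq (m : Fin (n - 3)) : z.diagonal m = chord n z.leftEnd (m + 2) := by
  rw [ZigZag.diagonal, chord, z.right_eq, z.leftEnd_add_two]

theorem ZigZag.diagonals_eq : z.diagonals = (Ico 2 (n - 1)).image (chord n z.leftEnd) := by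
  ext e
  simp only [ZigZag.diagonals, mem_image, mem_univ, true_and, mem_Ico]
  constructor
  · rintro ⟨m, rfl⟩
    exact ⟨m + 2, by omega, (z.diagonal_eq m).symm⟩
  · rintro ⟨m, hm, rfl⟩
    refine ⟨⟨m - 2, by omega⟩, ?_⟩
    rw [z.diagonal_eq]
    congr 1
    simp only
    omega

variable [NeZero n]

theorem ZigZag.chordWeight_of_mem_sides (k : Type*) [Field k] (hn : 3 ≤ n) {e : Finset (ZMod n)}
    (he : e ∈ sides n) : z.chordWeight k e = 1 := by
  refine prod_eq_one fun m hm => ?_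
  rw [mem_filter] at hm
  have := z.isStaircase.isTriangulation hn
  rw [← z.diagonals_eq] at this
  exact absurd he (this.2.1 e (mem_image.2 ⟨m, mem_univ _, hm.2⟩)).2

/-- Distinct rows give distinct chords, so the product defining the weight has a single factor; the
chords of rows `1` and `n - 1` are sides. -/
theorem ZigZag.chordWeight_chord (k : Type*) [Field k] (hn : 3 ≤ n) {m : ℕ} (h1 : 1 ≤ m)
    (hm : m < n) : algebraMap _ (RationalFn k n) (z.chordWeight k (chord n z.leftEnd m)) =
      rowWeight k n m := by
  by_cases h : 2 ≤ m ∧ m < n - 1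
  · obtain ⟨j, rfl⟩ : ∃ j : Fin (n - 3), m = j + 2 := ⟨⟨m - 2, by omega⟩, by simp only; omega⟩
    rw [rowWeight_add_two, ZigZag.chordWeight, formalVar]
    congr 1
    have : (univ.filter fun m : Fin (n - 3) => z.diagonal m = chord n z.leftEnd (j + 2)) = {j} := by
      ext i
      simp only [mem_filter, mem_univ, true_and, mem_singleton, z.diagonal_eq]
      constructor
      · intro h
        have := z.isStaircase.chord_injOn (n := n) (by simp; omega) (by simp; omega) h
        ext; omega
      · rintro rfl; rfl
    rw [this, prod_singleton]
  · rw [rowWeight, dif_neg h, z.chordWeight_of_mem_sides k hn, map_one]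
    have hw := z.isStaircase.window (n := n) (m := m) (by omega)
    rw [chord, pair_mem_sides hn hw.1 (by omega) hw.2]
    rcases h1.eq_or_lt with rfl | h1
    · left; simp
    · obtain rfl : m = n - 1 := by omega
      right; omega

end

theorem rowWeight_ne_zero {k : Type*} [Field k] {n : ℕ} (m : ℕ) : rowWeight k n m ≠ 0 := by
  rw [rowWeight]
  split_ifs
  · exact formalVar_ne_zero _
  · exact one_ne_zero

/-! ### The table of determinants and its properties -/

section

variable {k : Type*} [Field k] {n : ℕ} (z : ZigZag n)

/-- The table of an antiperiodic sequence of vectors. -/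
noncomputable def tableOf (A : ℤ) (v : ℤ → RationalFn k n × RationalFn k n) (p : Entry n) : RationalFn k n :=
  pairing (antiperiodize n A v) p.left p.right

theorem isFriezeTable_tableOf (hn : 3 ≤ n) {v : ℤ → RationalFn k n × RationalFn k n}
    (hv : Realizes z.leftEnd (rowWeight k n) (n - 1) v) :
    IsFriezeTable z (tableOf (z.leftEnd (n - 1)) v) := by
  have hL := z.isStaircase
  have hside := pairing_antiperiodize_side (show 2 ≤ n by omega)
    (show rowWeight k n (n - 1) = 1 by rw [rowWeight, dif_neg (by omega)]) hv
  refine ⟨fun p hp => ?_, fun p hp => ?_, fun m => ?_, fun A B C D h => ?_⟩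
  · rw [tableOf, show p.right = p.left + 1 by rw [Entry.row] at hp; omega]
    exact hside _
  -- By antiperiodicity a bottom entry is the determinant of two neighbours, up to a sign and an
  -- exchange that cancel.
  · have e := antiperiodize_add (show 0 < n by omega) (z.leftEnd (n - 1)) v (p.left - 1)
    have hs := hside (p.left - 1)
    rw [sub_add_cancel] at hs
    rw [tableOf, show p.right = p.left - 1 + n by rw [Entry.row] at hp; omega]
    simp only [pairing, e, Prod.fst_neg, Prod.snd_neg] at hs ⊢
    linear_combination hs
  · have hm := m.isLt
    have hw := hL.window (n := n) (m := m + 2) (by omega)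
    have hc := hv.chord (m + 2) (by omega) (by omega)
    rw [rowWeight_add_two] at hc
    rw [← hc, tableOf, z.right_eq, ← z.leftEnd_add_two, pairing_antiperiodize,
      windowLift_eq hw.1 (by omega), windowLift_eq (by omega) hw.2, Int.ediv_eq_zero_of_lt,
      Int.ediv_eq_zero_of_lt] <;> first | omega | simp
  · obtain ⟨⟨h1, h2⟩, ⟨h3, h4⟩, ⟨h5, h6⟩, -⟩ := h
    simp only [tableOf]
    rw [h5, h6, h3, h4, h2, h1]
    -- The two end points of `A` and their outer neighbours: two of the six determinants are sides
    -- and equal `1`, the other four are the diamond.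
    have hp := pairing_plucker (antiperiodize n (z.leftEnd (n - 1)) v) (A.left - 1) A.left A.right
      (A.right + 1)
    have hs := hside (A.left - 1)
    rw [sub_add_cancel] at hs
    rw [hs, hside] at hp
    linear_combination -hp

variable [NeZero n]

theorem ZigZag.algebraMap_matchingSum (hn : 3 ≤ n) {v : ℤ → RationalFn k n × RationalFn k n}
    (hv : Realizes z.leftEnd (rowWeight k n) (n - 1) v) {x y : ZMod n} (hxy : x ≠ y) :
    algebraMap _ (RationalFn k n) (z.matchingSum k x y) =
      windowPairing (z.leftEnd (n - 1)) v x y * ∏ m, formalVar k n m := by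
  have hL := z.isStaircase
  have hside : ∀ i : ℤ, z.leftEnd (n - 1) ≤ i → i + 1 < z.leftEnd (n - 1) + n →
      algebraMap _ (RationalFn k n) (z.chordWeight k {(i : ZMod n), ((i + 1 : ℤ) : ZMod n)}) = 1 := by
    intro i hi hi'
    rw [z.chordWeight_of_mem_sides k hn ((pair_mem_sides hn hi (by omega) hi').2 (Or.inl rfl)),
      map_one]
  have key := hL.incidenceSum_eq (c := fun e => algebraMap _ (RationalFn k n) (z.chordWeight k e))
    hv (fun m h1 hm => z.chordWeight_chord k hn h1 hm) hside (m := n - 1) (by omega) (by omega)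
  have huniv : (Icc (z.leftEnd (n - 1)) (z.leftEnd (n - 1) + (n - 1 : ℕ))).image
      (Int.cast : ℤ → ZMod n) = univ := by
    refine eq_univ_iff_forall.2 fun x => ?_
    obtain ⟨i, hi, hi', rfl⟩ := exists_cast_window (z.leftEnd (n - 1)) x
    exact mem_image_of_mem _ (mem_Icc.2 ⟨hi, by omega⟩)
  rw [huniv] at key
  rw [← prod_rowWeight hn, ← key x (mem_univ _) y (mem_univ _) hxy, ZigZag.matchingSum,
    perfectMatchings_eq, z.diagonals_eq, hL.triangles_eq hn, incidenceSum]
  simp only [map_sum, map_prod]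

/-- This brings every entry into one window, where the positivity induction and the matching formula
are available. -/
theorem tableOf_eq {A : ℤ} (v : ℤ → RationalFn k n × RationalFn k n) (p : Entry n) :
    ∃ i j : ℤ, A ≤ i ∧ i < j ∧ j < A + n ∧ tableOf A v p = pairing v i j ∧
      tableOf A v p = windowPairing A v (p.left : ZMod n) (p.right : ZMod n) ∧
      (p.left : ZMod n) ≠ (p.right : ZMod n) := by
  have hn : 0 < n := Nat.pos_of_ne_zero (NeZero.ne n)
  have hp := p.row_le
  have hx1 := le_windowLift hn A p.left
  have hy1 := le_windowLift hn A p.right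
  have hx2 := windowLift_lt hn A p.left
  have hy2 := windowLift_lt hn A p.right
  rw [← cast_windowLift n A p.left, ← cast_windowLift n A p.right]
  rcases pairing_antiperiodize_cases hn A v p.one_le_row (by omega) with ⟨h, e⟩ | ⟨h, e⟩
  · refine ⟨_, _, hx1, h, hy2, e, ?_, ?_⟩
    · rw [windowPairing_cast v hx1 h.le hy2]; exact e
    · rw [Ne, cast_inj_of_window hx1 hx2 hy1 hy2]; exact h.ne
  · refine ⟨_, _, hy1, h, hx2, e, ?_, ?_⟩
    · rw [windowPairing_comm, windowPairing_cast v hy1 h.le hx2]; exact e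
    · rw [Ne, cast_inj_of_window hx1 hx2 hy1 hy2]; exact h.ne'

theorem glideSymmetric_tableOf (A : ℤ) (v : ℤ → RationalFn k n × RationalFn k n) :
    GlideSymmetric (tableOf (n := n) A v) := by
  intro p q h1 h2
  have e := antiperiodize_add (Nat.pos_of_ne_zero (NeZero.ne n)) A v p.left
  rw [tableOf, tableOf, h1, h2]
  simp only [pairing, e, Prod.fst_neg, Prod.snd_neg]
  ring

theorem rowPeriodic_tableOf (A : ℤ) (v : ℤ → RationalFn k n × RationalFn k n) :
    RowPeriodic (tableOf (n := n) A v) := by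
  intro p q h1 h2
  have hn : 0 < n := Nat.pos_of_ne_zero (NeZero.ne n)
  rw [tableOf, tableOf, h1, h2]
  simp only [pairing, antiperiodize_add hn, Prod.fst_neg, Prod.snd_neg]
  ring

/-- It is applied twice: to positivity of the Laurent expansion and to nonvanishing. -/
theorem tableOf_induction (hn : 3 ≤ n) (P : RationalFn k n → Prop) (hone : P 1)
    (hadd : ∀ x y, P x → P y → P (x + y)) (hmul : ∀ x m, P x → P (x * formalVar k n m))
    (hdiv : ∀ x m, P x → P (x / formalVar k n m)) {v : ℤ → RationalFn k n × RationalFn k n}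
    (hv : Realizes z.leftEnd (rowWeight k n) (n - 1) v) (p : Entry n) :
    P (tableOf (z.leftEnd (n - 1)) v p) := by
  obtain ⟨i, j, hi, hij, hj, e, -⟩ := tableOf_eq (A := z.leftEnd (n - 1)) v p
  rw [e]
  refine hv.induction z.isStaircase rowWeight_ne_zero P hone hadd ?_ ?_ hi hij (by omega)
  · intro m x hx
    rw [rowWeight]
    split_ifs
    · exact hmul _ _ hx
    · simpa using hx
  · intro m x hx
    rw [rowWeight]
    split_ifs
    · exact hdiv _ _ hx
    · simpa using hx

end

end FriezeTable

/-! ### The theorem -/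

theorem theorem2 (k : Type*) [Field k] [CharZero k] (n : ℕ) [NeZero n] (hn : 3 ≤ n)
    (z : ZigZag n) :
    (∃! f : Entry n → RationalFn k n, IsFriezeTable z f) ∧
    IsTriangulation z.diagonals ∧
    ∀ f : Entry n → RationalFn k n, IsFriezeTable z f →
      GlideSymmetric f ∧
      RowPeriodic f ∧
      (∀ p : Entry n, IsPositiveLaurent (f p)) ∧
      (∀ p : Entry n, f p =
        algebraMap (MvPolynomial (Fin (n - 3)) k) (RationalFn k n)
          (z.matchingSum k p.left p.right) / ∏ m, formalVar k n m) := by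
  obtain ⟨v, hv⟩ := z.isStaircase.exists_realizes (X := rowWeight k n) rowWeight_ne_zero
    (by simp [rowWeight]) (M := n - 1) (by omega)
  have htable := isFriezeTable_tableOf z hn hv
  have hne : ∀ p, tableOf (z.leftEnd (n - 1)) v p ≠ 0 := fun p => HasPositiveValue.ne_zero
    (tableOf_induction z hn HasPositiveValue hasPositiveValue_one (fun _ _ => HasPositiveValue.add)
      (fun _ m h => h.mul_formalVar m) (fun _ m h => h.div_formalVar m) hv p)
  refine ⟨⟨_, htable, fun f hf => hf.eq_of_ne_zero htable hne⟩, ?_, fun f hf => ?_⟩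
  · rw [z.diagonals_eq]
    exact z.isStaircase.isTriangulation hn
  · rw [hf.eq_of_ne_zero htable hne]
    refine ⟨glideSymmetric_tableOf _ _, rowPeriodic_tableOf _ _, fun p =>
      tableOf_induction z hn IsPositiveLaurent isPositiveLaurent_one
        (fun _ _ => IsPositiveLaurent.add) (fun _ m h => h.mul_formalVar m)
        (fun _ m h => h.div_formalVar m) hv p, fun p => ?_⟩
    obtain ⟨-, -, -, -, -, -, e, hpne⟩ := tableOf_eq (A := z.leftEnd (n - 1)) v p
    rw [eq_div_iff (prod_ne_zero_iff.2 fun m _ => formalVar_ne_zero m),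
      z.algebraMap_matchingSum hn hv hpne, e]
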